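/- Let $N\ge 0$, $m\ge 1$, and let $\mathbb T^N=\mathbb R^N/\mathbb Z^N$. For $i=1,\dots,m$ let $H_i:\mathbb T^N\times\mathbb R^N\to\mathbb R$ be continuous, convex in the second variable, and such that $\alpha_i(|p|)\le H_i(x,p)\le\beta_i(|p|)$ for all $(x,p)$, where $\alpha_i,\beta_i:[0,\infty)\to\mathbb R$ tend to $+\infty$ at $+\infty$. Let $B(x)=(b_{ij}(x))$ be an $m\times m$ matrix depending continuously on $x\in\mathbb T^N$ such that, for every $x$: $b_{ij}(x)\le 0$ for $j\ne i$; $\sum_j b_{ij}(x)=0$ for every $i$; and $B(x)$ is irreducible, i.e. for every nonempty proper subset $I$ of $\{1,\dots,m\}$ there are $i\in I$, $j\notin I$ with $b_{ij}(x)\neq 0$. For $a\in\mathbb R$ consider the system $$H_i(x,Du_i)+(B(x)\mathbf u(x))_i=a\quad\text{in }\mathbb T^N,\qquad i=1,\dots,m. \tag{$S_a$}$$ A continuous $\mathbf u:\mathbb T^N\to\mathbb R^m$ is a (viscosity) subsolution of $(S_a)$ if $H_i(x,p)+(B(x)\mathbf u(x))_i\le a$ for all $i$, $x$ and $p\in D^+u_i(x)$,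 a supersolution if $H_i(x,p)+(B(x)\mathbf u(x))_i\ge a$ for all $i$, $x$ and $p\in D^-u_i(x)$, and a solution if it is both; here $D^{+}u(x)$ (resp. $D^-u(x)$) is the set of gradients $D\phi(x)$ of functions $\phi$ of class $C^1$ near $x$ such that $u-\phi$ has a local maximum (resp. minimum) at $x$. Let $\mathcal H(a)$ be the set of subsolutions of $(S_a)$, and assume that the critical value $c=\inf\{a\in\mathbb R:\mathcal H(a)\ne\varnothing\}$ is equal to $0$. Set $\Phi_{i,j}(y,x)=\sup_{\mathbf v\in\mathcal H(0)}\big(v_i(x)-v_j(y)\big)$, fix any index $i\in\{1,\dots,m\}$, and define the Aubry set $$\mathcal A=\{y\in\mathbb T^N:\ \Phi_{\cdot,i}(y,\cdot)=(\Phi_{1,i}(y,\cdot),\dots,\Phi_{m,i}(y,\cdot))\text{ is a solution of }(S_0)\}.$$ A function $\mathbf v\in\mathcal H(0)$ is called strict at $y$ if for every $k\in\{1,\dots,m\}$ there are an open neighborhood $V$ of $y$ and $\delta>0$ such that $v_k$ is differentiable at $x$ and $H_k(x,Dv_k(x))+(B(x)\mathbf v(x))_k<-\delta$ for almost every $x\in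 V$. Theorem. There exists $\mathbf v\in\mathcal H(0)$ which is strict at every point of $\mathbb T^N\setminus\mathcal A$. Moreover, $\mathcal A$ is closed and nonempty. -/

import Mathlib

open Set Filter Topology MeasureTheory
open scoped NNReal

namespace WeaklyCoupled

noncomputable section

/-- The space `ℝ^N` with its Euclidean norm. -/
abbrev Euc (N : ℕ) : Type := EuclideanSpace ℝ (Fin N)

/-- The flat torus `𝕋^N = ℝ^N / ℤ^N`. -/
abbrev Torus (N : ℕ) : Type := UnitAddTorus (Fin N)

/-- The canonical projection `ℝ^N → 𝕋^N`. -/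
def proj {N : ℕ} (z : Euc N) : Torus N := fun k => ((z k : ℝ) : UnitAddCircle)

/-- The set `D⁺u(x)` of superdifferentials of `u : 𝕋^N → ℝ` at `x`: the gradients at `x` of the
`C¹` supertangents of `u` at `x`. Functions near `x` are read as functions near a lift `z` of `x`
to `ℝ^N`; by periodicity the choice of the lift is irrelevant. -/
def superdifferential {N : ℕ} (u : Torus N → ℝ) (x : Torus N) : Set (Euc N) :=
  {p | ∃ (z : Euc N) (φ : Euc N → ℝ), proj z = x ∧ ContDiffAt ℝ 1 φ z ∧
    IsLocalMax (fun w => u (proj w) - φ w) z ∧ HasGradientAt φ p z}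

/-- The set `D⁻u(x)` of subdifferentials of `u : 𝕋^N → ℝ` at `x`. -/
def subdifferential {N : ℕ} (u : Torus N → ℝ) (x : Torus N) : Set (Euc N) :=
  {p | ∃ (z : Euc N) (φ : Euc N → ℝ), proj z = x ∧ ContDiffAt ℝ 1 φ z ∧
    IsLocalMin (fun w => u (proj w) - φ w) z ∧ HasGradientAt φ p z}

/-- Convex Hamiltonians: continuous, convex in the momentum, and bounded from below and from above
by coercive functions of the norm of the momentum. -/
structure IsConvexHamiltonian {N : ℕ} (H : Torus N → Euc N → ℝ) : Prop where
  continuous : Continuous (fun q : Torus N × Euc N => H q.1 q.2)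
  convex : ∀ x, ConvexOn ℝ univ (H x)
  coercive : ∃ α β : ℝ≥0 → ℝ, Tendsto α atTop atTop ∧ Tendsto β atTop atTop ∧
    ∀ x p, α ‖p‖₊ ≤ H x p ∧ H x p ≤ β ‖p‖₊

/-- Coupling matrices. -/
def IsCoupling {m : ℕ} (B : Matrix (Fin m) (Fin m) ℝ) : Prop :=
  (∀ i j, j ≠ i → B i j ≤ 0) ∧ ∀ i, 0 ≤ ∑ j, B i j

/-- Degenerate matrices: all the rows sum to zero. -/
def IsDegenerate {m : ℕ} (B : Matrix (Fin m) (Fin m) ℝ) : Prop :=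
  ∀ i, ∑ j, B i j = 0

/-- Irreducible matrices: no nonempty proper set of indices is decoupled from its complement. -/
def IsIrreducible {m : ℕ} (B : Matrix (Fin m) (Fin m) ℝ) : Prop :=
  ∀ I : Set (Fin m), I.Nonempty → I ≠ univ → ∃ i ∈ I, ∃ j ∉ I, B i j ≠ 0

/-- `(B(x) u(x))_i`. -/
def couplingTerm {N m : ℕ} (B : Torus N → Matrix (Fin m) (Fin m) ℝ)
    (u : Fin m → Torus N → ℝ) (i : Fin m) (x : Torus N) : ℝ :=
  ∑ j, B x i j * u j x

/-- Continuous viscosity subsolutions of `H_i(x, Du_i) + (B(x)u(x))_i = a`, `i = 1, …, m`. -/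
def IsSubsolution {N m : ℕ} (H : Fin m → Torus N → Euc N → ℝ)
    (B : Torus N → Matrix (Fin m) (Fin m) ℝ) (a : ℝ) (u : Fin m → Torus N → ℝ) : Prop :=
  (∀ i, Continuous (u i)) ∧
    ∀ i x, ∀ p ∈ superdifferential (u i) x, H i x p + couplingTerm B u i x ≤ a

/-- Continuous viscosity supersolutions of `H_i(x, Du_i) + (B(x)u(x))_i = a`, `i = 1, …, m`. -/
def IsSupersolution {N m : ℕ} (H : Fin m → Torus N → Euc N → ℝ)
    (B : Torus N → Matrix (Fin m) (Fin m) ℝ) (a : ℝ) (u : Fin m → Torus N → ℝ) : Prop :=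
  (∀ i, Continuous (u i)) ∧
    ∀ i x, ∀ p ∈ subdifferential (u i) x, a ≤ H i x p + couplingTerm B u i x

/-- Viscosity solutions. -/
def IsSolution {N m : ℕ} (H : Fin m → Torus N → Euc N → ℝ)
    (B : Torus N → Matrix (Fin m) (Fin m) ℝ) (a : ℝ) (u : Fin m → Torus N → ℝ) : Prop :=
  IsSubsolution H B a u ∧ IsSupersolution H B a u

/-- The set `𝓗(a)` of subsolutions of the system at level `a`. -/
def subsolutions {N m : ℕ} (H : Fin m → Torus N → Euc N → ℝ)
    (B : Torus N → Matrix (Fin m) (Fin m) ℝ) (a : ℝ) : Set (Fin m → Torus N → ℝ) :=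
  {u | IsSubsolution H B a u}

/-- The critical value `c = inf {a ∈ ℝ : 𝓗(a) ≠ ∅}`. -/
def criticalValue {N m : ℕ} (H : Fin m → Torus N → Euc N → ℝ)
    (B : Torus N → Matrix (Fin m) (Fin m) ℝ) : ℝ :=
  sInf {a : ℝ | (subsolutions H B a).Nonempty}

/-- The Mañé matrix `Φ_{i,j}(y,x) = sup_{v ∈ 𝓗(0)} (v_i(x) - v_j(y))`. -/
def maneMatrix {N m : ℕ} (H : Fin m → Torus N → Euc N → ℝ)
    (B : Torus N → Matrix (Fin m) (Fin m) ℝ) (i j : Fin m) (y x : Torus N) : ℝ :=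
  sSup ((fun v : Fin m → Torus N → ℝ => v i x - v j y) '' subsolutions H B 0)

/-- The Aubry set, defined through the fixed index `i`: the set of the points `y` such that
`Φ_{·,i}(y,·)` is a solution of the system at level `0`. -/
def aubrySet {N m : ℕ} (H : Fin m → Torus N → Euc N → ℝ)
    (B : Torus N → Matrix (Fin m) (Fin m) ℝ) (i : Fin m) : Set (Torus N) :=
  {y | IsSolution H B 0 (fun k x => maneMatrix H B k i y x)}

/-- `v_i` is strict at `y`: on a neighbourhood `V` of `y` one has, for some `δ > 0`,
`H_i(x, Dv_i(x)) + (B(x)v(x))_i < -δ` for almost every `x ∈ V`. Almost every `x` in `V ⊆ 𝕋^N` means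
the same as almost every `z` in the (periodic) preimage of `V` in `ℝ^N`, and `Dv_i(x)` is the
gradient at `z` of the periodic lift of `v_i`. -/
def IsComponentStrictAt {N m : ℕ} (H : Fin m → Torus N → Euc N → ℝ)
    (B : Torus N → Matrix (Fin m) (Fin m) ℝ) (v : Fin m → Torus N → ℝ) (i : Fin m)
    (y : Torus N) : Prop :=
  ∃ V : Set (Torus N), IsOpen V ∧ y ∈ V ∧ ∃ δ : ℝ, 0 < δ ∧
    ∀ᵐ z : Euc N, proj z ∈ V →
      DifferentiableAt ℝ (fun w => v i (proj w)) z ∧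
        H i (proj z) (gradient (fun w => v i (proj w)) z) + couplingTerm B v i (proj z) < -δ

/-- `v` is strict at `y`: every component is. -/
def IsStrictAt {N m : ℕ} (H : Fin m → Torus N → Euc N → ℝ)
    (B : Torus N → Matrix (Fin m) (Fin m) ℝ) (v : Fin m → Torus N → ℝ) (y : Torus N) : Prop :=
  ∀ i, IsComponentStrictAt H B v i y

end

end WeaklyCoupled

/-! The proof works with pairs (v, f), where f ≤ 0 is continuous and v is a subsolution with
right-hand side f; v is strict at y as soon as every f_k(y) < 0
(`IsReinforcedSubsolution.isStrictAt`). Fix y outside 𝓐. The function w = Φ_{·,i}(y,·) is a critical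
subsolution, and the largest one whose i-th component vanishes at y. Since it is not a solution, the
supersolution test fails for some component k at some point x. Then w_k can be raised near x, and
the other equations only improve because the off-diagonal entries of B are nonpositive. Maximality
of w forces (k, x) = (i, y), so the raised function has f_i(y) < 0 (`exists_strict_component`).
Irreducibility carries the strictness from component i to all the others
(`IsReinforcedSubsolution.spread`). The sets where such pairs are strict are open, so countably many
pairs suffice for the complement of 𝓐, and an infinite convex combination is strict wherever one of
its terms is (`exists_reinforced_combination`). If 𝓐 were empty, compactness would give a
subsolution at a negative level, against c = 0. Three tools carry this: the uniform estimates of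
`exists_apriori_bound`; the stability lemma `isSubsolutionWith_of_approx`, which handles suprema,
limits and, after a change of sign, the closedness of 𝓐; and `superjet_convex_combination`, which
makes subsolutions a convex set by doubling variables. -/

namespace WeaklyCoupled

/-! ### Calculus of superjets on a Euclidean space. -/

section Superjet

variable {E : Type*} [NormedAddCommGroup E] [InnerProductSpace ℝ E]

section Gradient

variable [CompleteSpace E]

theorem hasGradientAt_add {f g : E → ℝ} {p q z : E} (hf : HasGradientAt f p z)
    (hg : HasGradientAt g q z) : HasGradientAt (fun w => f w + g w) (p + q) z := by
  rw [hasGradientAt_iff_hasFDerivAt] at *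
  rw [map_add]
  exact hf.add hg

theorem hasGradientAt_const_mul {f : E → ℝ} {p z : E} (c : ℝ) (hf : HasGradientAt f p z) :
    HasGradientAt (fun w => c * f w) (c • p) z := by
  rw [hasGradientAt_iff_hasFDerivAt] at *
  have : (InnerProductSpace.toDual ℝ E) (c • p) = c • (InnerProductSpace.toDual ℝ E) p := by
    simp
  rw [this]
  exact hf.const_mul c

theorem hasGradientAt_neg {f : E → ℝ} {p z : E} (hf : HasGradientAt f p z) :
    HasGradientAt (fun w => -f w) (-p) z := by
  simpa using hasGradientAt_const_mul (-1) hf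

theorem hasGradientAt_sub {f g : E → ℝ} {p q z : E} (hf : HasGradientAt f p z)
    (hg : HasGradientAt g q z) : HasGradientAt (fun w => f w - g w) (p - q) z := by
  simpa [sub_eq_add_neg] using hasGradientAt_add hf (hasGradientAt_neg hg)

theorem hasGradientAt_add_const {f : E → ℝ} {p z : E} (hf : HasGradientAt f p z) (c : ℝ) :
    HasGradientAt (fun w => f w + c) p z := by
  rw [hasGradientAt_iff_hasFDerivAt] at *
  exact hf.add_const c

theorem hasGradientAt_norm_sub_sq (a w : E) :
    HasGradientAt (fun x => ‖x - a‖ ^ 2) ((2 : ℝ) • (w - a)) w := by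
  rw [hasGradientAt_iff_hasFDerivAt]
  have h : HasFDerivAt (fun x : E => ‖x - a‖ ^ 2) _ w :=
    ((hasFDerivAt_id (𝕜 := ℝ) w).sub_const a).norm_sq
  refine h.congr_fderiv ?_
  ext v
  simp

theorem hasGradientAt_inner_sub (p a w : E) :
    HasGradientAt (fun x => inner ℝ p (x - a)) p w := by
  rw [hasGradientAt_iff_hasFDerivAt]
  have h : HasFDerivAt (fun x : E => inner ℝ p (x - a)) _ w :=
    ((innerSL ℝ p).hasFDerivAt (x := w - a)).comp w ((hasFDerivAt_id (𝕜 := ℝ) w).sub_const a)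
  refine h.congr_fderiv ?_
  ext v
  simp

theorem hasGradientAt_comp_smul_add {f : E → ℝ} {p : E} (c : ℝ) (b z : E)
    (hf : HasGradientAt f p (c • z + b)) :
    HasGradientAt (fun w => f (c • w + b)) (c • p) z := by
  rw [hasGradientAt_iff_hasFDerivAt] at *
  have h : HasFDerivAt (fun w => f (c • w + b)) _ z :=
    hf.comp z (((hasFDerivAt_id (𝕜 := ℝ) z).const_smul c).add_const b)
  refine h.congr_fderiv ?_
  ext v
  simp

theorem contDiffAt_eventually_gradient {φ : E → ℝ} {p z : E} (hφ : ContDiffAt ℝ 1 φ z)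
    (hp : HasGradientAt φ p z) {ε : ℝ} (hε : 0 < ε) :
    ∀ᶠ w in 𝓝 z, ContDiffAt ℝ 1 φ w ∧ ∃ q, HasGradientAt φ q w ∧ dist q p < ε := by
  have h1 := hφ.eventually (by simp)
  have h2 : ContinuousAt (gradient φ) z :=
    (InnerProductSpace.toDual ℝ E).symm.continuous.continuousAt.comp
      (hφ.continuousAt_fderiv (by simp))
  have h3 := Metric.continuousAt_iff'.1 h2 ε hε
  filter_upwards [h1, h3] with w hw hw3
  refine ⟨hw, gradient φ w, (hw.differentiableAt (by simp)).hasGradientAt, ?_⟩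
  rwa [hp.gradient] at hw3

/-- The gradients at `z` of the `C¹` functions touching `U` from above at `z`. -/
def superjet (U : E → ℝ) (z : E) : Set E :=
  {p | ∃ φ : E → ℝ, ContDiffAt ℝ 1 φ z ∧ IsLocalMax (fun w => U w - φ w) z ∧ HasGradientAt φ p z}

theorem superjet_of_le {U V : E → ℝ} {z p : E} (hle : ∀ᶠ w in 𝓝 z, U w ≤ V w) (hz : U z = V z)
    (hp : p ∈ superjet V z) : p ∈ superjet U z := by
  obtain ⟨φ, h1, h2, h3⟩ := hp
  refine ⟨φ, h1, ?_, h3⟩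
  filter_upwards [hle, h2] with w hw hw2
  linarith

theorem superjet_add_const {U : E → ℝ} {z p : E} (c : ℝ)
    (hp : p ∈ superjet (fun w => U w + c) z) : p ∈ superjet U z := by
  obtain ⟨φ, h1, h2, h3⟩ := hp
  refine ⟨φ, h1, ?_, h3⟩
  filter_upwards [h2] with w hw
  linarith

theorem superjet_eq_of_hasGradientAt {U : E → ℝ} {z p q : E} (hp : p ∈ superjet U z)
    (hq : HasGradientAt U q z) : p = q := by
  obtain ⟨φ, h1, h2, h3⟩ := hp
  have h := h2.hasFDerivAt_eq_zero (hasGradientAt_iff_hasFDerivAt.1 (hasGradientAt_sub hq h3))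
  have : q - p = 0 := (InnerProductSpace.toDual ℝ E).map_eq_zero_iff.1 h
  exact (sub_eq_zero.1 this).symm

theorem superjet_add_contDiff {U ψ : E → ℝ} {z p q : E} (hψ : ContDiffAt ℝ 1 ψ z)
    (hq : HasGradientAt ψ q z) (hp : p ∈ superjet (fun w => U w + ψ w) z) :
    p - q ∈ superjet U z := by
  obtain ⟨φ, h1, h2, h3⟩ := hp
  refine ⟨fun w => φ w - ψ w, h1.sub hψ, ?_, hasGradientAt_sub h3 hq⟩
  filter_upwards [h2] with w hw
  linarith

theorem superjet_const_mul {U : E → ℝ} {z p : E} {c : ℝ} (hc : 0 < c)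
    (hp : p ∈ superjet (fun w => c * U w) z) : c⁻¹ • p ∈ superjet U z := by
  obtain ⟨φ, h1, h2, h3⟩ := hp
  refine ⟨fun w => c⁻¹ * φ w, contDiffAt_const.mul h1, ?_, hasGradientAt_const_mul _ h3⟩
  filter_upwards [h2] with w hw
  have := mul_le_mul_of_nonneg_left hw (inv_pos.2 hc).le
  rw [mul_sub, mul_sub, inv_mul_cancel_left₀ hc.ne', inv_mul_cancel_left₀ hc.ne'] at this
  exact this

end Gradient

section Proper

variable [ProperSpace E]

/-- A maximum over the compact closed ball cannot sit on the sphere, where `g` is below `g z`. All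
the touching points below are produced this way. -/
theorem exists_isLocalMax_ball {X : Type*} [PseudoMetricSpace X] [ProperSpace X] {g : X → ℝ}
    {a z : X} {r : ℝ}
    (hg : ContinuousOn g (Metric.closedBall a r)) (hz : z ∈ Metric.closedBall a r)
    (hs : ∀ w, dist w a = r → g w < g z) :
    ∃ w ∈ Metric.ball a r, IsLocalMax g w ∧ g z ≤ g w := by
  obtain ⟨w, hw, hmax⟩ := (isCompact_closedBall a r).exists_isMaxOn ⟨z, hz⟩ hg
  have hwz : g z ≤ g w := hmax hz
  have hwb : w ∈ Metric.ball a r := by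
    rcases lt_or_eq_of_le (Metric.mem_closedBall.1 hw) with h | h
    · exact h
    · exact absurd (hs w h) (not_lt.2 hwz)
  exact ⟨w, hwb, hmax.isLocalMax (Metric.closedBall_mem_nhds_of_mem hwb), hwz⟩

/-- Adding `‖w - z‖ ^ 2` to the test function makes the contact strict, so it survives a small
perturbation. Only an upper bound on `V` near `z` and a lower bound at `z` itself are needed, which
is why suprema can be treated like uniform limits. -/
theorem superjet_perturb {U : E → ℝ} {z p : E} (hU : ContinuousAt U z) (hp : p ∈ superjet U z)
    {ε : ℝ} (hε : 0 < ε) :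
    ∃ δ > 0, ∀ V : E → ℝ, Continuous V → (∀ w ∈ Metric.closedBall z ε, V w ≤ U w + δ) →
      U z - δ ≤ V z → ∃ w ∈ Metric.ball z ε, ∃ q ∈ superjet V w, dist q p < ε ∧ |V w - U z| < ε := by
  obtain ⟨φ, h1, h2, h3⟩ := hp
  have e1 := contDiffAt_eventually_gradient h1 h3 (half_pos hε)
  have e2 := Metric.continuousAt_iff'.1 h1.continuousAt (ε / 4) (by positivity)
  have e3 := Metric.continuousAt_iff'.1 hU (ε / 4) (by positivity)
  obtain ⟨r, hr, hball⟩ := Metric.nhds_basis_closedBall.mem_iff.1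
    (inter_mem (inter_mem e1 e2) (inter_mem e3 h2))
  obtain ⟨s, hs, hsr, hsε⟩ : ∃ s > 0, s ≤ r ∧ s ≤ ε / 5 :=
    ⟨min r (ε / 5), by positivity, min_le_left _ _, min_le_right _ _⟩
  -- On the sphere of radius `s` the penalty `s ^ 2` must beat the total error `2δ`; the bound `ε /
  -- 8` is for the estimate of `V w - U z`.
  refine ⟨min (s ^ 2 / 4) (ε / 8), by positivity, fun V hV hVU hVz => ?_⟩
  set δ := min (s ^ 2 / 4) (ε / 8) with hδ
  have hδ1 : δ ≤ s ^ 2 / 4 := min_le_left _ _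
  have hδ2 : δ ≤ ε / 8 := min_le_right _ _
  have hin : ∀ w ∈ Metric.closedBall z s, w ∈ Metric.closedBall z r := fun w hw =>
    Metric.closedBall_subset_closedBall hsr hw
  have hin' : ∀ w ∈ Metric.closedBall z s, w ∈ Metric.closedBall z ε := fun w hw =>
    Metric.closedBall_subset_closedBall (by linarith) hw
  have hcont : ContinuousOn (fun w => V w - (φ w + ‖w - z‖ ^ 2)) (Metric.closedBall z s) := by
    intro w hw
    have hc := (hball (hin w hw)).1.1.1.continuousAt
    exact (hV.continuousAt.sub (hc.add (by fun_prop))).continuousWithinAt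
  obtain ⟨w, hw, hmax, hge⟩ := exists_isLocalMax_ball (z := z) hcont
    (Metric.mem_closedBall_self hs.le) (by
      intro w hw
      have hw' : w ∈ Metric.closedBall z s := by simp [hw]
      have i1 := hVU w (hin' w hw')
      have i2 : U w - φ w ≤ U z - φ z := (hball (hin w hw')).2.2
      have i3 : ‖w - z‖ = s := by rw [← dist_eq_norm, hw]
      simp only [i3, sub_self, norm_zero]
      have : 0 < s ^ 2 := by positivity
      nlinarith)
  have hwc := Metric.ball_subset_closedBall hw
  obtain ⟨⟨⟨hw1, q, hq, hqp⟩, hw2⟩, hw3, hw4⟩ := hball (hin w hwc)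
  have hnorm : ‖w - z‖ < s := by rw [← dist_eq_norm]; exact hw
  refine ⟨w, Metric.ball_subset_ball (by linarith) hw, q + (2 : ℝ) • (w - z),
    ⟨fun x => φ x + ‖x - z‖ ^ 2, hw1.add ?_, hmax, hasGradientAt_add hq
      (hasGradientAt_norm_sub_sq z w)⟩, ?_, ?_⟩
  · exact ((contDiff_id.sub contDiff_const).norm_sq ℝ).contDiffAt
  · calc dist (q + (2 : ℝ) • (w - z)) p ≤ dist (q + (2 : ℝ) • (w - z)) q + dist q p :=
          dist_triangle _ _ _
      _ = 2 * ‖w - z‖ + dist q p := by simp [dist_eq_norm, norm_smul]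
      _ < ε := by linarith
  · simp only [sub_self, norm_zero] at hge
    have i1 := hVU w (hin' w hwc)
    simp only [Real.dist_eq, Set.mem_ofPred_eq] at hw2 hw3
    rw [abs_lt] at hw2 hw3 ⊢
    have : 0 ≤ ‖w - z‖ ^ 2 := by positivity
    constructor <;> nlinarith

/-- If `U` grew from `z` faster than `R`, a cone with vertex `z` and slope `R' > R` would touch it
from above away from the vertex, where the gradient of the cone has norm at least `R'`. -/
theorem lipschitz_of_superjet_bound {U : E → ℝ} (hU : Continuous U) {M R : ℝ}
    (hM : ∀ z, |U z| ≤ M) (hR : ∀ z, ∀ p ∈ superjet U z, ‖p‖ ≤ R) (hR0 : 0 ≤ R) (z w : E) :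
    U w - U z ≤ R * ‖w - z‖ := by
  by_contra! hlt
  have hwz : 0 < ‖w - z‖ := by
    rcases (norm_nonneg (w - z)).lt_or_eq with h | h
    · exact h
    · rw [← h, mul_zero] at hlt
      have : w = z := by rw [← sub_eq_zero, ← norm_eq_zero, ← h]
      simp [this] at hlt
  set R' := (R + (U w - U z) / ‖w - z‖) / 2 with hR'
  have h1 : R < (U w - U z) / ‖w - z‖ := by rwa [lt_div_iff₀ hwz]
  have h2 : R < R' := by linarith
  have h3 : R' * ‖w - z‖ < U w - U z := by
    rw [← lt_div_iff₀ hwz]; linarith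
  have hR'0 : 0 < R' := by linarith
  -- At this radius the cone exceeds the oscillation of `U`, which is at most `2 * M`.
  set r := max ‖w - z‖ ((2 * M + 1) / R') with hr
  have hM0 : 0 ≤ M := (abs_nonneg _).trans (hM z)
  have hrw : ‖w - z‖ ≤ r := le_max_left _ _
  have hrM : 2 * M + 1 ≤ R' * r := by
    have := le_max_right ‖w - z‖ ((2 * M + 1) / R')
    rw [div_le_iff₀ hR'0] at this
    linarith
  obtain ⟨x, hx, hmax, hge⟩ := exists_isLocalMax_ball (g := fun x => U x - R' * ‖x - z‖)
    (a := z) (z := w) (r := r) (by fun_prop) (by simpa [dist_eq_norm] using hrw) (by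
      intro x hx
      rw [dist_eq_norm] at hx
      simp only [hx]
      have := abs_le.1 (hM x)
      have := abs_le.1 (hM z)
      linarith)
  have hxz : x - z ≠ 0 := by
    intro h0
    rw [sub_eq_zero.1 h0] at hge
    simp at hge
    linarith
  have hnx : 0 < ‖x - z‖ := norm_pos_iff.2 hxz
  have hcd : ContDiffAt ℝ 1 (fun y : E => R' * ‖y - z‖) x := contDiffAt_const.mul
    ((contDiffAt_norm ℝ hxz).comp x (contDiffAt_id.sub contDiffAt_const))
  have hgrad : HasGradientAt (fun y : E => R' * ‖y - z‖)
      (gradient (fun y : E => R' * ‖y - z‖) x) x :=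
    (hcd.differentiableAt (by simp)).hasGradientAt
  set p := gradient (fun y : E => R' * ‖y - z‖) x
  have hpR := hR x p ⟨_, hcd, hmax, hgrad⟩
  -- The radial derivative of the cone, computed in two ways, gives `‖p‖ ≥ R'` by Cauchy–Schwarz.
  have hder : HasDerivAt (fun t : ℝ => R' * ‖(x + t • (x - z)) - z‖) (inner ℝ p (x - z)) 0 := by
    have hl : HasDerivAt (fun t : ℝ => x + t • (x - z)) (x - z) 0 := by
      simpa using ((hasDerivAt_id (0 : ℝ)).smul_const (x - z)).const_add x
    have := (hasGradientAt_iff_hasFDerivAt.1 (by simpa using hgrad : HasGradientAt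
      (fun y : E => R' * ‖y - z‖) p (x + (0 : ℝ) • (x - z)))).comp_hasDerivAt 0 hl
    exact this.congr_deriv (by simp)
  have hder2 : HasDerivAt (fun t : ℝ => R' * ‖(x + t • (x - z)) - z‖) (R' * ‖x - z‖) 0 := by
    have : (fun t : ℝ => R' * ‖(x + t • (x - z)) - z‖) =ᶠ[𝓝 0]
        fun t => R' * ((1 + t) * ‖x - z‖) := by
      filter_upwards [lt_mem_nhds (show (-1 : ℝ) < 0 by norm_num)] with t ht
      have e : x + t • (x - z) - z = (1 + t) • (x - z) := by module
      rw [e, norm_smul, Real.norm_of_nonneg (by linarith)]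
    refine HasDerivAt.congr_of_eventuallyEq ?_ this
    have := (((hasDerivAt_id (0 : ℝ)).const_add 1).mul_const ‖x - z‖).const_mul R'
    simpa using this
  have heq := hder.unique hder2
  have hcs := real_inner_le_norm p (x - z)
  rw [heq] at hcs
  have : R' ≤ ‖p‖ := le_of_mul_le_mul_right hcs hnx
  linarith

/-- The affine part of `U` plus a paraboloid touches `U` near `z`. A nearby point is enough, since
the equations are continuous in all their arguments. -/
theorem superjet_near_of_hasGradientAt {U : E → ℝ} (hU : Continuous U) {z p : E}
    (hp : HasGradientAt U p z) {ε : ℝ} (hε : 0 < ε) :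
    ∃ w ∈ Metric.ball z ε, ∃ q ∈ superjet U w, dist q p < ε := by
  have h1 := (hasGradientAt_iff_isLittleO.1 hp).def (show 0 < ε / 8 by positivity)
  obtain ⟨r, hr, hball⟩ := Metric.nhds_basis_closedBall.mem_iff.1 h1
  obtain ⟨s, hs, hsr, hsε⟩ : ∃ s > 0, s ≤ r ∧ s ≤ ε :=
    ⟨min r ε, by positivity, min_le_left _ _, min_le_right _ _⟩
  obtain ⟨w, hw, hmax, -⟩ := exists_isLocalMax_ball
    -- On the sphere the paraboloid equals `ε * s / 4`, above the first-order error `ε * s / 8`,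
    -- while its gradient inside the ball stays below `ε / 2`.
    (g := fun w => U w - (inner ℝ p (w - z) + (ε / 4 / s) * ‖w - z‖ ^ 2))
    (a := z) (z := z) (r := s) (by fun_prop) (Metric.mem_closedBall_self hs.le) (by
      intro w hw
      have hw' : w ∈ Metric.closedBall z r := by simp [hw, hsr]
      have i := hball hw'
      have i3 : ‖w - z‖ = s := by rw [← dist_eq_norm, hw]
      simp only [Set.mem_ofPred_eq, i3, Real.norm_eq_abs] at i
      have i' := (abs_le.1 i).2
      simp only [sub_self, inner_zero_right, norm_zero, i3]
      have : ε / 4 / s * s ^ 2 = ε / 4 * s := by field_simp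
      rw [this]
      have : 0 < ε * s := by positivity
      nlinarith)
  refine ⟨w, Metric.ball_subset_ball hsε hw, p + (ε / 4 / s) • ((2 : ℝ) • (w - z)),
    ⟨_, ?_, hmax, hasGradientAt_add (hasGradientAt_inner_sub p z w) (hasGradientAt_const_mul _
      (hasGradientAt_norm_sub_sq z w))⟩, ?_⟩
  · have : ContDiff ℝ 1 (fun w : E => inner ℝ p (w - z) + (ε / 4 / s) * ‖w - z‖ ^ 2) :=
      (contDiff_const.inner ℝ (contDiff_id.sub contDiff_const)).add
        (contDiff_const.mul ((contDiff_id.sub contDiff_const).norm_sq ℝ))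
    exact this.contDiffAt
  · have hnorm : ‖w - z‖ < s := by rw [← dist_eq_norm]; exact hw
    rw [dist_eq_norm, add_sub_cancel_left, norm_smul, norm_smul, Real.norm_of_nonneg (by positivity),
      Real.norm_of_nonneg (by norm_num)]
    calc ε / 4 / s * (2 * ‖w - z‖) ≤ ε / 4 / s * (2 * s) := by gcongr
      _ = ε / 2 := by field_simp; norm_num
      _ < ε := by linarith

theorem superjet_nonempty_near {U : E → ℝ} (hU : Continuous U) (z : E) {ε : ℝ} (hε : 0 < ε) :
    ∃ w ∈ Metric.ball z ε, (superjet U w).Nonempty := by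
  obtain ⟨r, hr, hball⟩ := Metric.nhds_basis_closedBall.mem_iff.1
    (Metric.continuousAt_iff'.1 hU.continuousAt 1 one_pos : ∀ᶠ w in 𝓝 z, dist (U w) (U z) < 1)
  obtain ⟨s, hs, hsr, hsε⟩ : ∃ s > 0, s ≤ r ∧ s ≤ ε :=
    ⟨min r ε, by positivity, min_le_left _ _, min_le_right _ _⟩
  obtain ⟨w, hw, hmax, -⟩ := exists_isLocalMax_ball
    (g := fun w => U w - (2 / s ^ 2) * ‖w - z‖ ^ 2)
    (a := z) (z := z) (r := s) (by fun_prop) (Metric.mem_closedBall_self hs.le) (by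
      intro w hw
      have i := hball (show w ∈ Metric.closedBall z r by simp [hw, hsr])
      have i3 : ‖w - z‖ = s := by rw [← dist_eq_norm, hw]
      simp only [Set.mem_ofPred_eq, Real.dist_eq] at i
      have i' := (abs_lt.1 i).2
      simp only [sub_self, norm_zero, i3]
      have : 2 / s ^ 2 * s ^ 2 = 2 := by field_simp
      rw [this]
      norm_num
      linarith)
  refine ⟨w, Metric.ball_subset_ball hsε hw, _, _, ?_, hmax, hasGradientAt_const_mul _
      (hasGradientAt_norm_sub_sq z w)⟩
  exact (contDiff_const.mul ((contDiff_id.sub contDiff_const).norm_sq ℝ)).contDiffAt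

end Proper

end Superjet

/-! ### Doubling of variables for convex combinations. -/

section Doubling

variable {E : Type*} [NormedAddCommGroup E] [InnerProductSpace ℝ E] [ProperSpace E]

set_option maxHeartbeats 1000000 in
/-- Superjets of a convex combination of two Lipschitz functions are approximated by the
convex combinations of superjets at nearby points. -/
theorem superjet_convex_combination {U V : E → ℝ} {R l : ℝ} (hR : 0 ≤ R)
    (hU : ∀ z w, U w - U z ≤ R * ‖w - z‖) (hV : ∀ z w, V w - V z ≤ R * ‖w - z‖)
    (hUc : Continuous U) (hVc : Continuous V)
    (hl0 : 0 < l) (hl1 : l < 1) {z p : E}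
    (hp : p ∈ superjet (fun w => l * U w + (1 - l) * V w) z) {ε : ℝ} (hε : 0 < ε) :
    ∃ x ∈ Metric.ball z ε, ∃ y ∈ Metric.ball z ε, ∃ q ∈ superjet U x, ∃ q' ∈ superjet V y,
      dist (l • q + (1 - l) • q') p < ε := by
  obtain ⟨φ, h1, h2, h3⟩ := hp
  have e1 := contDiffAt_eventually_gradient h1 h3 (half_pos hε)
  obtain ⟨r, hr, hball⟩ := Metric.nhds_basis_closedBall.mem_iff.1 (inter_mem e1 h2)
  obtain ⟨s, hs, hsr, hsε⟩ : ∃ s > 0, s ≤ r ∧ s ≤ ε / 5 :=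
    ⟨min r (ε / 5), by positivity, min_le_left _ _, min_le_right _ _⟩
  have hin : ∀ w ∈ Metric.closedBall z s, w ∈ Metric.closedBall z r := fun w hw =>
    Metric.closedBall_subset_closedBall hsr hw
  have hl1' : 0 < 1 - l := by linarith
  have hmem : ∀ x ∈ Metric.closedBall z s, ∀ y ∈ Metric.closedBall z s,
      l • x + (1 - l) • y ∈ Metric.closedBall z s := fun x hx y hy =>
    convex_closedBall z s hx hy hl0.le hl1'.le (by ring)
  -- the penalization parameter
  obtain ⟨n, hn1, hnA, hnB⟩ : ∃ n : ℝ, 0 < n ∧ R ^ 2 * (64 / s ^ 2) ≤ n ∧ R * (8 / s) ≤ n := by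
    refine ⟨max 1 (max (R ^ 2 * (64 / s ^ 2)) (R * (8 / s))), by positivity, ?_, ?_⟩ <;> simp
  set Θ : E → ℝ := fun w => φ w + ‖w - z‖ ^ 2 with hΘ
  have hΘc : ∀ w ∈ Metric.closedBall z s, ContDiffAt ℝ 1 Θ w := fun w hw =>
    (hball (hin w hw)).1.1.add ((contDiff_id.sub contDiff_const).norm_sq ℝ).contDiffAt
  -- Evaluating `Θ` at the weighted mean of the two points makes its gradient split with weights `l`
  -- and `1 - l` between them.
  set G : E × E → ℝ := fun a => l * U a.1 + (1 - l) * V a.2 - Θ (l • a.1 + (1 - l) • a.2)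
    - n * ‖a.1 - a.2‖ ^ 2 with hG
  have hGc : ContinuousOn G (Metric.closedBall z s ×ˢ Metric.closedBall z s) := by
    intro a ha
    have c1 : ContinuousAt Θ (l • a.1 + (1 - l) • a.2) :=
      (hΘc _ (hmem _ ha.1 _ ha.2)).continuousAt
    have c2 : ContinuousAt (fun a : E × E => Θ (l • a.1 + (1 - l) • a.2)) a :=
      ContinuousAt.comp (f := fun a : E × E => l • a.1 + (1 - l) • a.2) c1 (by fun_prop)
    refine ContinuousAt.continuousWithinAt ?_
    refine ContinuousAt.sub (ContinuousAt.sub ?_ c2) ?_ <;> fun_prop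
  obtain ⟨⟨x, y⟩, ⟨hx, hy⟩, hmax⟩ :=
    ((isCompact_closedBall z s).prod (isCompact_closedBall z s)).exists_isMaxOn
    ⟨(z, z), by simp [hs.le]⟩ hGc
  simp only at hx hy
  set m := l • x + (1 - l) • y with hm
  have hmm := hmem x hx y hy
  have hxm : x - m = (1 - l) • (x - y) := by rw [hm]; module
  have hym : y - m = l • (y - x) := by rw [hm]; module
  have nxm : ‖x - m‖ = (1 - l) * ‖x - y‖ := by
    rw [hxm, norm_smul, Real.norm_of_nonneg hl1'.le]
  have nym : ‖y - m‖ = l * ‖x - y‖ := by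
    rw [hym, norm_smul, Real.norm_of_nonneg hl0.le, norm_sub_rev]
  set d := ‖x - y‖ with hd
  have hd0 : 0 ≤ d := norm_nonneg _
  have hUm := hU m x
  have hVm := hV m y
  rw [nxm] at hUm
  rw [nym] at hVm
  have hll : 2 * (l * (1 - l)) ≤ 1 := by nlinarith [sq_nonneg (l - (1 - l))]
  have hsum : l * (U x - U m) + (1 - l) * (V y - V m) ≤ R * d := by
    have a1 := mul_le_mul_of_nonneg_left hUm hl0.le
    have a2 := mul_le_mul_of_nonneg_left hVm hl1'.le
    have a3 : 2 * (l * (1 - l)) * (R * d) ≤ 1 * (R * d) :=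
      mul_le_mul_of_nonneg_right hll (by positivity)
    nlinarith
  have hmm_self : l • m + (1 - l) • m = m := by module
  have hzz_self : l • z + (1 - l) • z = z := by module
  -- Comparison with `(m, m)` gives `n * d ≤ R`. Comparison with `(z, z)`, together with the
  -- maximality of `z`, gives `‖m - z‖ ^ 2 ≤ R * d`. Hence for large `n` both points lie inside the
  -- ball.
  have b1 : G (m, m) ≤ G (x, y) := hmax (show (m, m) ∈ _ from ⟨hmm, hmm⟩)
  have b2 : G (z, z) ≤ G (x, y) := hmax (show (z, z) ∈ _ from
    ⟨Metric.mem_closedBall_self hs.le, Metric.mem_closedBall_self hs.le⟩)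
  have b3 : l * U m + (1 - l) * V m - φ m ≤ l * U z + (1 - l) * V z - φ z :=
    (hball (hin m hmm)).2
  simp only [hG, hΘ, hmm_self, hzz_self, sub_self, norm_zero, ← hm, ← hd] at b1 b2
  have hnd : n * d ≤ R := by
    rcases hd0.lt_or_eq with h | h
    · have : n * d ^ 2 ≤ R * d := by nlinarith
      have : n * d * d ≤ R * d := by nlinarith
      exact le_of_mul_le_mul_right this h
    · rw [← h]; simpa using hR
  have hmz : ‖m - z‖ ^ 2 ≤ R * d := by nlinarith [mul_nonneg hn1.le (sq_nonneg d)]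
  have hnR : n * (R * d) ≤ R ^ 2 := by nlinarith
  have key1 : ‖m - z‖ < s / 2 := by
    have g2 : n * (s ^ 2 / 64) ≥ R ^ 2 := by
      have := mul_le_mul_of_nonneg_right hnA (show 0 ≤ s ^ 2 / 64 by positivity)
      have e : R ^ 2 * (64 / s ^ 2) * (s ^ 2 / 64) = R ^ 2 := by field_simp
      linarith
    have g3 : R * d ≤ s ^ 2 / 64 := le_of_mul_le_mul_left (hnR.trans g2) hn1
    refine lt_of_pow_lt_pow_left₀ 2 (by positivity) ?_
    have : 0 < s ^ 2 := by positivity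
    nlinarith
  have key2 : d < s / 2 := by
    have g2 : n * (s / 8) ≥ R := by
      have := mul_le_mul_of_nonneg_right hnB (show 0 ≤ s / 8 by positivity)
      have e : R * (8 / s) * (s / 8) = R := by field_simp
      linarith
    have g3 : d ≤ s / 8 := le_of_mul_le_mul_left (hnd.trans g2) hn1
    linarith
  have hxz : x ∈ Metric.ball z s := by
    rw [Metric.mem_ball, dist_eq_norm]
    calc ‖x - z‖ = ‖(x - m) + (m - z)‖ := by congr 1; abel
      _ ≤ ‖x - m‖ + ‖m - z‖ := norm_add_le _ _
      _ < s := by rw [nxm]; nlinarith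
  have hyz : y ∈ Metric.ball z s := by
    rw [Metric.mem_ball, dist_eq_norm]
    calc ‖y - z‖ = ‖(y - m) + (m - z)‖ := by congr 1; abel
      _ ≤ ‖y - m‖ + ‖m - z‖ := norm_add_le _ _
      _ < s := by rw [nym]; nlinarith
  obtain ⟨⟨hφm, g, hg, hgp⟩, -⟩ := hball (hin m hmm)
  have hgΘ : HasGradientAt Θ (g + (2 : ℝ) • (m - z)) m :=
    hasGradientAt_add hg (hasGradientAt_norm_sub_sq z m)
  set g' := g + (2 : ℝ) • (m - z) with hg'
  -- the superjets at `x` and `y`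
  have J1 : l • g' + n • ((2 : ℝ) • (x - y)) ∈ superjet (fun w => l * U w) x := by
    refine ⟨fun w => Θ (l • w + (1 - l) • y) + n * ‖w - y‖ ^ 2, ?_, ?_, ?_⟩
    · refine ContDiffAt.add ?_
        (contDiff_const.mul ((contDiff_id.sub contDiff_const).norm_sq ℝ)).contDiffAt
      exact ContDiffAt.comp x (g := Θ) (f := fun w => l • w + (1 - l) • y) (hΘc m hmm)
        (by fun_prop)
    · filter_upwards [Metric.closedBall_mem_nhds_of_mem hxz] with w hw
      have := hmax (show (w, y) ∈ _ from ⟨hw, hy⟩)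
      simp only [hG, Set.mem_ofPred_eq] at this
      linarith
    · exact hasGradientAt_add (hasGradientAt_comp_smul_add l ((1 - l) • y) x hgΘ)
        (hasGradientAt_const_mul n (hasGradientAt_norm_sub_sq y x))
  have J2 : (1 - l) • g' + n • ((2 : ℝ) • (y - x)) ∈ superjet (fun w => (1 - l) * V w) y := by
    have hm' : m = (1 - l) • y + l • x := by rw [hm]; abel
    refine ⟨fun w => Θ ((1 - l) • w + l • x) + n * ‖w - x‖ ^ 2, ?_, ?_, ?_⟩
    · refine ContDiffAt.add ?_
        (contDiff_const.mul ((contDiff_id.sub contDiff_const).norm_sq ℝ)).contDiffAt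
      exact ContDiffAt.comp y (g := Θ) (f := fun w => (1 - l) • w + l • x)
        (by rw [← hm']; exact hΘc m hmm) (by fun_prop)
    · filter_upwards [Metric.closedBall_mem_nhds_of_mem hyz] with w hw
      have := hmax (show (x, w) ∈ _ from ⟨hx, hw⟩)
      simp only [hG, Set.mem_ofPred_eq] at this
      rw [add_comm ((1 - l) • w), add_comm ((1 - l) • y), norm_sub_rev w, norm_sub_rev y]
      linarith
    · exact hasGradientAt_add (hasGradientAt_comp_smul_add (1 - l) (l • x) y (by rwa [← hm']))
        (hasGradientAt_const_mul n (hasGradientAt_norm_sub_sq x y))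
  refine ⟨x, Metric.ball_subset_ball (by linarith) hxz, y, Metric.ball_subset_ball (by linarith) hyz,
    _, superjet_const_mul hl0 J1, _, superjet_const_mul hl1' J2, ?_⟩
  -- The two penalty gradients are opposite and cancel.
  have e : l • l⁻¹ • (l • g' + n • (2 : ℝ) • (x - y)) +
      (1 - l) • (1 - l)⁻¹ • ((1 - l) • g' + n • (2 : ℝ) • (y - x)) = g' := by
    rw [smul_inv_smul₀ hl0.ne', smul_inv_smul₀ hl1'.ne']
    module
  rw [e]
  calc dist g' p ≤ dist g' g + dist g p := dist_triangle _ _ _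
    _ = 2 * ‖m - z‖ + dist g p := by simp [hg', dist_eq_norm, norm_smul]
    _ < ε := by linarith

end Doubling

/-! ### The covering of the torus by Euclidean space. -/

section Projection

variable {N : ℕ}

theorem isOpenQuotientMap_proj : IsOpenQuotientMap (proj : Euc N → Torus N) := by
  have h1 : IsOpenQuotientMap (fun (x : Fin N → ℝ) k => ((x k : ℝ) : UnitAddCircle)) :=
    IsOpenQuotientMap.piMap (fun _ => QuotientAddGroup.isOpenQuotientMap_mk)
  exact h1.comp (EuclideanSpace.equiv (Fin N) ℝ).toHomeomorph.isOpenQuotientMap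

theorem continuous_proj : Continuous (proj : Euc N → Torus N) := isOpenQuotientMap_proj.continuous

theorem proj_surjective : Function.Surjective (proj : Euc N → Torus N) :=
  isOpenQuotientMap_proj.surjective

theorem continuous_comp_proj_iff {u : Torus N → ℝ} :
    Continuous (fun z => u (proj z)) ↔ Continuous u :=
  isOpenQuotientMap_proj.continuous_comp_iff

end Projection

/-! ### Subsolutions with variable right-hand side: stability, Lipschitz bounds, convexity. -/

section System

variable {N m : ℕ} {H : Fin m → Torus N → Euc N → ℝ} {B : Torus N → Matrix (Fin m) (Fin m) ℝ}

/-- Viscosity subsolutions of the system with a variable right-hand side `f`. -/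
def IsSubsolutionWith (H : Fin m → Torus N → Euc N → ℝ) (B : Torus N → Matrix (Fin m) (Fin m) ℝ)
    (f u : Fin m → Torus N → ℝ) : Prop :=
  (∀ k, Continuous (u k)) ∧ ∀ k z, ∀ p ∈ superjet (fun w => u k (proj w)) z,
    H k (proj z) p + couplingTerm B u k (proj z) ≤ f k (proj z)

theorem isSubsolution_iff {a : ℝ} {u : Fin m → Torus N → ℝ} :
    IsSubsolution H B a u ↔ IsSubsolutionWith H B (fun _ _ => a) u := by
  refine and_congr_right fun _ => forall_congr' fun k => ?_
  constructor
  · rintro h z p ⟨φ, h1, h2, h3⟩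
    exact h _ p ⟨z, φ, rfl, h1, h2, h3⟩
  · rintro h x p ⟨z, φ, rfl, h1, h2, h3⟩
    exact h z p ⟨φ, h1, h2, h3⟩

theorem couplingTerm_neg (u : Fin m → Torus N → ℝ) (k : Fin m) (x : Torus N) :
    couplingTerm B (fun k x => -u k x) k x = -couplingTerm B u k x := by
  simp [couplingTerm, Finset.sum_neg_distrib]

theorem mem_subdifferential_iff {u : Torus N → ℝ} {x : Torus N} {p : Euc N} :
    p ∈ subdifferential u x ↔ ∃ z, proj z = x ∧ -p ∈ superjet (fun w => -u (proj w)) z := by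
  constructor
  · rintro ⟨z, φ, hz, h1, h2, h3⟩
    refine ⟨z, hz, fun w => -φ w, h1.neg, ?_, hasGradientAt_neg h3⟩
    filter_upwards [h2] with w hw
    linarith
  · rintro ⟨z, hz, φ, h1, h2, h3⟩
    refine ⟨z, fun w => -φ w, hz, h1.neg, ?_, by simpa using hasGradientAt_neg h3⟩
    filter_upwards [h2] with w hw
    linarith

/-- The change of sign lets the stability lemma serve supersolutions too; that lemma requires
continuity of the Hamiltonians but not convexity. -/
theorem isSupersolution_iff {a : ℝ} {u : Fin m → Torus N → ℝ} :
    IsSupersolution H B a u ↔ IsSubsolutionWith (fun k x q => -H k x (-q)) B (fun _ _ => -a)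
      (fun k x => -u k x) := by
  refine and_congr (forall_congr' fun k => ⟨fun h => h.neg, fun h => (funext fun x => neg_neg (u k x) : (fun x => - -u k x) = u k) ▸ h.neg⟩)
    (forall_congr' fun k => ?_)
  constructor
  · intro h z p hp
    have := h (proj z) (-p) (mem_subdifferential_iff.2 ⟨z, rfl, by simpa using hp⟩)
    rw [couplingTerm_neg]
    linarith
  · rintro h x p hp
    obtain ⟨z, rfl, hz⟩ := mem_subdifferential_iff.1 hp
    have := h z _ hz
    rw [couplingTerm_neg] at this
    simp only [neg_neg] at this
    linarith

theorem continuous_couplingTerm (hB : ∀ i j, Continuous fun x => B x i j)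
    {u : Fin m → Torus N → ℝ} (hu : ∀ k, Continuous (u k)) (k : Fin m) :
    Continuous (couplingTerm B u k) :=
  continuous_finsetSum _ fun j _ => (hB k j).mul (hu j)

theorem couplingTerm_eq_add_erase (u : Fin m → Torus N → ℝ) (k : Fin m) (x : Torus N) :
    couplingTerm B u k x = B x k k * u k x + ∑ j ∈ Finset.univ.erase k, B x k j * u j x :=
  (Finset.add_sum_erase _ (fun j => B x k j * u j x) (Finset.mem_univ k)).symm

theorem couplingTerm_add_const (hBd : ∀ x, IsDegenerate (B x)) (u : Fin m → Torus N → ℝ) (c : ℝ)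
    (k : Fin m) (x : Torus N) :
    couplingTerm B (fun k x => u k x + c) k x = couplingTerm B u k x := by
  simp only [couplingTerm, mul_add, Finset.sum_add_distrib, ← Finset.sum_mul, hBd x k, zero_mul,
    add_zero]

theorem couplingTerm_combo (u v : Fin m → Torus N → ℝ) (a b : ℝ) (k : Fin m) (x : Torus N) :
    couplingTerm B (fun k x => a * u k x + b * v k x) k x =
      a * couplingTerm B u k x + b * couplingTerm B v k x := by
  simp only [couplingTerm, Finset.mul_sum, ← Finset.sum_add_distrib]
  exact Finset.sum_congr rfl fun j _ => by ring

theorem IsSubsolutionWith.mono {f g u : Fin m → Torus N → ℝ} (h : IsSubsolutionWith H B f u)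
    (hfg : ∀ k x, f k x ≤ g k x) : IsSubsolutionWith H B g u :=
  ⟨h.1, fun k z p hp => (h.2 k z p hp).trans (hfg k _)⟩

theorem IsSubsolutionWith.add_const (hBd : ∀ x, IsDegenerate (B x)) {f u : Fin m → Torus N → ℝ}
    (h : IsSubsolutionWith H B f u) (c : ℝ) :
    IsSubsolutionWith H B f (fun k x => u k x + c) := by
  refine ⟨fun k => (h.1 k).add continuous_const, fun k z p hp => ?_⟩
  rw [couplingTerm_add_const hBd]
  exact h.2 k z p (superjet_add_const c hp)

/-- Stability of subsolutions: `u` is a subsolution as soon as each of its values is approached by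
subsolutions that lie almost below `u`. -/
theorem isSubsolutionWith_of_approx (hH : ∀ k, Continuous fun q : Torus N × Euc N => H k q.1 q.2)
    (hB : ∀ i j, Continuous fun x => B x i j) (hBc : ∀ x, IsCoupling (B x))
    {f u : Fin m → Torus N → ℝ} (hu : ∀ k, Continuous (u k)) (hf : ∀ k, Continuous (f k))
    (h : ∀ k x, ∀ ε > 0, ∃ v g, IsSubsolutionWith H B g v ∧ (∀ j y, v j y ≤ u j y + ε) ∧
      u k x - ε ≤ v k x ∧ ∀ y, g k y ≤ f k y + ε) : IsSubsolutionWith H B f u := by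
  refine ⟨hu, fun k z p hp => ?_⟩
  by_contra! hlt
  -- The diagonal term follows the value of the approximant, which is controlled at the contact
  -- point. The off-diagonal terms keep `u j` plus an error: since `B k j ≤ 0`, a one-sided bound on
  -- the approximants suffices there.
  set F : Euc N × Euc N × ℝ × ℝ → ℝ := fun a => H k (proj a.1) a.2.1 + (B (proj a.1) k k * a.2.2.1 +
    ∑ j ∈ Finset.univ.erase k, B (proj a.1) k j * (u j (proj a.1) + a.2.2.2)) - f k (proj a.1)
      - a.2.2.2 with hF
  have hFc : Continuous F := by
    have hpr : Continuous fun a : Euc N × Euc N × ℝ × ℝ => proj a.1 :=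
      continuous_proj.comp continuous_fst
    have i1 : Continuous fun a : Euc N × Euc N × ℝ × ℝ => H k (proj a.1) a.2.1 :=
      (hH k).comp (hpr.prodMk (by fun_prop))
    have i2 : ∀ j, Continuous fun a : Euc N × Euc N × ℝ × ℝ => B (proj a.1) k j :=
      fun j => (hB k j).comp hpr
    have i3 : ∀ j, Continuous fun a : Euc N × Euc N × ℝ × ℝ => u j (proj a.1) :=
      fun j => (hu j).comp hpr
    have i4 : Continuous fun a : Euc N × Euc N × ℝ × ℝ => f k (proj a.1) := (hf k).comp hpr
    refine ((i1.add (((i2 k).mul (by fun_prop)).add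
      (continuous_finsetSum _ fun j _ => (i2 j).mul ((i3 j).add (by fun_prop))))).sub i4).sub
      (by fun_prop)
  have hF0 : 0 < F (z, p, u k (proj z), 0) := by
    rw [couplingTerm_eq_add_erase] at hlt
    simp only [hF, add_zero]
    linarith
  obtain ⟨ε, hε, hball⟩ := Metric.mem_nhds_iff.1 (hFc.continuousAt.preimage_mem_nhds (lt_mem_nhds hF0))
  obtain ⟨δ, hδ, hpert⟩ := superjet_perturb ((hu k).comp continuous_proj).continuousAt hp hε
  have hτ : 0 < min δ (ε / 2) := by positivity
  set τ := min δ (ε / 2)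
  have hτδ : τ ≤ δ := min_le_left _ _
  have hτε : τ ≤ ε / 2 := min_le_right _ _
  obtain ⟨v, g, hv, hvu, hvz, hg⟩ := h k (proj z) τ hτ
  obtain ⟨w, hw, q, hq, hqp, hVU⟩ := hpert (fun w => v k (proj w)) ((hv.1 k).comp continuous_proj)
    (fun w _ => (hvu k _).trans (by simpa using hτδ)) (by simp only [Function.comp]; linarith)
  have hmem : (w, q, v k (proj w), τ) ∈ Metric.ball (z, p, u k (proj z), (0 : ℝ)) ε := by
    simp only [Metric.mem_ball, Prod.dist_eq, max_lt_iff]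
    refine ⟨hw, hqp, by simpa [Real.dist_eq] using hVU, ?_⟩
    rw [Real.dist_eq, sub_zero, abs_of_pos hτ]
    linarith
  have hpos : 0 < F (w, q, v k (proj w), τ) := hball hmem
  have hsub := hv.2 k w q hq
  rw [couplingTerm_eq_add_erase] at hsub
  have hsum : ∑ j ∈ Finset.univ.erase k, B (proj w) k j * (u j (proj w) + τ) ≤
      ∑ j ∈ Finset.univ.erase k, B (proj w) k j * v j (proj w) :=
    Finset.sum_le_sum fun j hj =>
      mul_le_mul_of_nonpos_left (hvu j _) ((hBc _).1 k j (Finset.ne_of_mem_erase hj))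
  have := hg (proj w)
  simp only [hF] at hpos
  linarith

/-- Coercivity. What matters is that `R` depends on `C` alone, not on `f` or `u`. -/
theorem exists_superjet_bound (hH : ∀ k, IsConvexHamiltonian (H k)) (C : ℝ) :
    ∃ R, 0 ≤ R ∧ ∀ f u, IsSubsolutionWith H B f u →
      (∀ k x, f k x - couplingTerm B u k x ≤ C) →
      ∀ k z, ∀ p ∈ superjet (fun w => u k (proj w)) z, ‖p‖ ≤ R := by
  choose α β hα _ hαβ using fun k => (hH k).coercive
  obtain ⟨R, hR⟩ := eventually_atTop.1
    (eventually_all.2 fun k => (hα k).eventually (eventually_gt_atTop C))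
  refine ⟨R, R.2, fun f u hu hC k z p hp => ?_⟩
  by_contra! hlt
  have h1 := hR ‖p‖₊ (by exact_mod_cast hlt.le) k
  have h2 := (hαβ k (proj z) p).1
  have h3 := hu.2 k z p hp
  have h4 := hC k (proj z)
  linarith

theorem exists_abs_le {u : Torus N → ℝ} (hu : Continuous u) : ∃ M, ∀ x, |u x| ≤ M := by
  obtain ⟨M, hM⟩ := isCompact_univ.exists_bound_of_continuousOn hu.continuousOn
  exact ⟨M, fun x => hM x (mem_univ x)⟩

theorem IsSubsolutionWith.exists_superjet_bound (hH : ∀ k, IsConvexHamiltonian (H k))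
    (hB : ∀ i j, Continuous fun x => B x i j) {f u : Fin m → Torus N → ℝ}
    (hf : ∀ k, Continuous (f k)) (h : IsSubsolutionWith H B f u) :
    ∃ R, 0 ≤ R ∧ ∀ k z, ∀ p ∈ superjet (fun w => u k (proj w)) z, ‖p‖ ≤ R := by
  choose M hM using fun k => exists_abs_le ((hf k).sub (continuous_couplingTerm hB h.1 k))
  obtain ⟨R, hR0, hR⟩ := WeaklyCoupled.exists_superjet_bound (B := B) hH (∑ k, |M k|)
  refine ⟨R, hR0, hR f u h fun k x => ?_⟩
  calc f k x - couplingTerm B u k x ≤ M k := (le_abs_self _).trans (hM k x)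
    _ ≤ |M k| := le_abs_self _
    _ ≤ ∑ k, |M k| := Finset.single_le_sum (f := fun k => |M k|) (fun _ _ => abs_nonneg _)
      (Finset.mem_univ k)

theorem IsSubsolutionWith.lipschitz {f u : Fin m → Torus N → ℝ} (h : IsSubsolutionWith H B f u)
    {R : ℝ} (hR0 : 0 ≤ R) (hR : ∀ k z, ∀ p ∈ superjet (fun w => u k (proj w)) z, ‖p‖ ≤ R)
    (k : Fin m) (z w : Euc N) : u k (proj w) - u k (proj z) ≤ R * ‖w - z‖ := by
  obtain ⟨M, hM⟩ := exists_abs_le (h.1 k)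
  exact lipschitz_of_superjet_bound ((h.1 k).comp continuous_proj) (fun z => hM (proj z)) (hR k)
    hR0 z w

/-- Convex combinations of subsolutions are subsolutions. -/
theorem IsSubsolutionWith.combo (hH : ∀ k, IsConvexHamiltonian (H k))
    (hB : ∀ i j, Continuous fun x => B x i j) {f g u v : Fin m → Torus N → ℝ}
    (hf : ∀ k, Continuous (f k)) (hg : ∀ k, Continuous (g k))
    (hu : IsSubsolutionWith H B f u) (hv : IsSubsolutionWith H B g v) {l : ℝ} (hl0 : 0 < l)
    (hl1 : l < 1) :
    IsSubsolutionWith H B (fun k x => l * f k x + (1 - l) * g k x)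
      (fun k x => l * u k x + (1 - l) * v k x) := by
  obtain ⟨R₁, hR₁0, hR₁⟩ := hu.exists_superjet_bound hH hB hf
  obtain ⟨R₂, hR₂0, hR₂⟩ := hv.exists_superjet_bound hH hB hg
  set R := max R₁ R₂
  have hR0 : 0 ≤ R := hR₁0.trans (le_max_left _ _)
  have hRu : ∀ k z, ∀ p ∈ superjet (fun w => u k (proj w)) z, ‖p‖ ≤ R := fun k z p hp =>
    (hR₁ k z p hp).trans (le_max_left _ _)
  have hRv : ∀ k z, ∀ p ∈ superjet (fun w => v k (proj w)) z, ‖p‖ ≤ R := fun k z p hp =>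
    (hR₂ k z p hp).trans (le_max_right _ _)
  have hl1' : 0 < 1 - l := by linarith
  refine ⟨fun k => ((hu.1 k).const_mul l).add ((hv.1 k).const_mul (1 - l)), fun k z p hp => ?_⟩
  rw [couplingTerm_combo]
  by_contra! hlt
  obtain ⟨η, hη, hlt⟩ : ∃ η > 0, l * f k (proj z) + (1 - l) * g k (proj z) + 4 * η <
      H k (proj z) p + (l * couplingTerm B u k (proj z) + (1 - l) * couplingTerm B v k (proj z)) :=
    ⟨(H k (proj z) p + (l * couplingTerm B u k (proj z) + (1 - l) * couplingTerm B v k (proj z))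
      - (l * f k (proj z) + (1 - l) * g k (proj z))) / 5, by linarith, by linarith⟩
  have hHc : Continuous fun a : Euc N × Euc N => H k (proj a.1) a.2 :=
    (hH k).continuous.comp ((continuous_proj.comp continuous_fst).prodMk continuous_snd)
  have e1 : ∀ᶠ q in 𝓝 p, H k (proj z) p - η < H k (proj z) q :=
    (hHc.comp (Continuous.prodMk_right z)).continuousAt.eventually (lt_mem_nhds (by simp [hη]))
  -- Uniformity over a compact set of momenta is needed because the superjets found later depend on
  -- how close to `z` they are taken.
  have e2 : ∀ᶠ x in 𝓝 z, ∀ q ∈ Metric.closedBall (0 : Euc N) R,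
      H k (proj z) q - η < H k (proj x) q := by
    refine (isCompact_closedBall _ _).eventually_forall_of_forall_eventually fun q _ => ?_
    have c : Continuous fun a : Euc N × Euc N => H k (proj a.1) a.2 - H k (proj z) a.2 :=
      hHc.sub (hHc.comp (continuous_const.prodMk continuous_snd))
    have := (c.continuousAt (x := (z, q))).eventually (lt_mem_nhds (a := -η) (by simp [hη]))
    filter_upwards [this] with a ha
    linarith
  have e3 : ∀ᶠ x in 𝓝 z, couplingTerm B u k (proj z) - f k (proj z) - η <
      couplingTerm B u k (proj x) - f k (proj x) :=
    (((continuous_couplingTerm hB hu.1 k).sub (hf k)).comp continuous_proj).continuousAt.eventually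
      (lt_mem_nhds (by simp [hη]))
  have e4 : ∀ᶠ x in 𝓝 z, couplingTerm B v k (proj z) - g k (proj z) - η <
      couplingTerm B v k (proj x) - g k (proj x) :=
    (((continuous_couplingTerm hB hv.1 k).sub (hg k)).comp continuous_proj).continuousAt.eventually
      (lt_mem_nhds (by simp [hη]))
  obtain ⟨ε₁, hε₁, hb₁⟩ := Metric.mem_nhds_iff.1 e1
  obtain ⟨ε₂, hε₂, hb₂⟩ := Metric.mem_nhds_iff.1 (e2.and (e3.and e4))
  obtain ⟨x, hx, y, hy, q, hq, q', hq', hqq⟩ := superjet_convex_combination hR0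
    (hu.lipschitz hR0 hRu k) (hv.lipschitz hR0 hRv k) ((hu.1 k).comp continuous_proj)
    ((hv.1 k).comp continuous_proj) hl0 hl1 hp (lt_min hε₁ hε₂)
  have i1 := hb₁ (show l • q + (1 - l) • q' ∈ Metric.ball p ε₁ from
    lt_of_lt_of_le hqq (min_le_left _ _))
  have i2 := hb₂ (Metric.ball_subset_ball (min_le_right _ _) hx)
  have i3 := hb₂ (Metric.ball_subset_ball (min_le_right _ _) hy)
  simp only [Set.mem_ofPred_eq] at i1 i2 i3
  have i4 := i2.1 q (by simpa using hRu k x q hq)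
  have i5 := i3.1 q' (by simpa using hRv k y q' hq')
  have i6 := ((hH k).convex (proj z)).2 (mem_univ q) (mem_univ q') hl0.le hl1'.le (by ring)
  simp only [smul_eq_mul] at i6
  have j1 := hu.2 k x q hq
  have j2 := hv.2 k y q' hq'
  have k1 : l * (H k (proj z) q + couplingTerm B u k (proj z) - f k (proj z)) ≤ l * (2 * η) :=
    mul_le_mul_of_nonneg_left (by linarith [i2.2.1]) hl0.le
  have k2 : (1 - l) * (H k (proj z) q' + couplingTerm B v k (proj z) - g k (proj z)) ≤
      (1 - l) * (2 * η) := mul_le_mul_of_nonneg_left (by linarith [i3.2.2]) hl1'.le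
  linarith

end System

/-! ### A priori estimates. -/

section APriori

variable {N m : ℕ} {H : Fin m → Torus N → Euc N → ℝ} {B : Torus N → Matrix (Fin m) (Fin m) ℝ}

theorem exists_lift_dist_le (N : ℕ) :
    ∃ D : ℝ, 0 ≤ D ∧ ∀ x y : Torus N, ∃ z w, proj z = x ∧ proj w = y ∧ ‖w - z‖ ≤ D := by
  obtain ⟨n, hn⟩ := (isCompact_univ (X := Torus N)).elim_directed_cover
    (fun n : ℕ => proj '' Metric.ball (0 : Euc N) n)
    (fun n => isOpenQuotientMap_proj.isOpenMap _ Metric.isOpen_ball)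
    (fun x _ => by
      obtain ⟨z, rfl⟩ := proj_surjective x
      obtain ⟨n, hn⟩ := exists_nat_gt ‖z‖
      exact mem_iUnion.2 ⟨n, z, by simpa using hn, rfl⟩)
    (Monotone.directed_le fun a b hab => image_mono (Metric.ball_subset_ball (by exact_mod_cast hab)))
  refine ⟨2 * n, by positivity, fun x y => ?_⟩
  obtain ⟨z, hz, rfl⟩ := hn (mem_univ x)
  obtain ⟨w, hw, rfl⟩ := hn (mem_univ y)
  refine ⟨z, w, rfl, rfl, (norm_sub_le _ _).trans ?_⟩
  rw [mem_ball_zero_iff] at hz hw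
  linarith

theorem sum_mul_eq_sum_mul_sub {b : Fin m → ℝ} (hb : ∑ j, b j = 0) (s : Fin m → ℝ) (c : ℝ) :
    ∑ j, b j * s j = ∑ j, b j * (s j - c) := by
  simp only [mul_sub, Finset.sum_sub_distrib, ← Finset.sum_mul, hb, zero_mul, sub_zero]

/-- Irreducibility couples some index `k` where `s` is maximal to one where it is not. In row `k` of
`A (s - c)` no term is negative and that one is positive. -/
theorem exists_pos_of_irreducible {A : Matrix (Fin m) (Fin m) ℝ} (hc : IsCoupling A)
    (hi : IsIrreducible A) (hd : IsDegenerate A) {s : Fin m → ℝ} {c : ℝ} (hs : ∀ k, s k ≤ c)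
    {i j : Fin m} (hsi : s i = c) (hsj : s j < c) : ∃ k, 0 < ∑ l, A k l * s l := by
  obtain ⟨k, hk, l, hl, hkl⟩ := hi {k | s k = c} ⟨i, hsi⟩ fun h => by
    have : j ∈ {k | s k = c} := h ▸ mem_univ j
    exact hsj.ne this
  rw [Set.mem_ofPred_eq] at hk hl
  refine ⟨k, ?_⟩
  rw [sum_mul_eq_sum_mul_sub (hd k) s c]
  refine Finset.sum_pos' (fun j _ => ?_) ⟨l, Finset.mem_univ l, ?_⟩
  · rcases eq_or_ne j k with rfl | hjk
    · simp [hk]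
    · exact mul_nonneg_of_nonpos_of_nonpos (hc.1 k j hjk) (by linarith [hs j])
  · have hlk : l ≠ k := fun h => hl (h ▸ hk)
    exact mul_pos_of_neg_of_neg (lt_of_le_of_ne (hc.1 k l hlk) hkl)
      (by linarith [lt_of_le_of_ne (hs l) hl])

/-- By zero row sums and homogeneity, `s` may be normalized to have minimum 0 and maximum 1. Such
vectors form a compact set on which the positive part of `B s` is nonzero by irreducibility, hence
bounded away from zero uniformly in `x`. -/
theorem exists_oscillation_bound (hB : ∀ i j, Continuous fun x => B x i j)
    (hBc : ∀ x, IsCoupling (B x)) (hBi : ∀ x, IsIrreducible (B x)) (hBd : ∀ x, IsDegenerate (B x))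
    (K : ℝ) : ∃ C, 0 ≤ C ∧ ∀ x (s : Fin m → ℝ), (∀ k, ∑ j, B x k j * s j ≤ K) →
      ∀ i j, s i - s j ≤ C := by
  have key : ∀ i j : Fin m, ∃ ε > 0, ∀ (x : Torus N) (s : Fin m → ℝ), (∀ k, s k ∈ Icc (0 : ℝ) 1) →
      s i = 1 → s j = 0 → ε ≤ ∑ k, max 0 (∑ l, B x k l * s l) := by
    intro i j
    have hK : IsCompact ((univ : Set (Torus N)) ×ˢ
        ((univ.pi fun _ : Fin m => Icc (0 : ℝ) 1) ∩ {s | s i = 1} ∩ {s | s j = 0})) := by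
      refine isCompact_univ.prod (((isCompact_univ_pi fun _ => isCompact_Icc).inter_right ?_).inter_right ?_)
      · exact isClosed_eq (continuous_apply i) continuous_const
      · exact isClosed_eq (continuous_apply j) continuous_const
    have hcont : Continuous fun a : Torus N × (Fin m → ℝ) =>
        ∑ k, max 0 (∑ l, B a.1 k l * a.2 l) :=
      continuous_finsetSum _ fun k _ => continuous_const.max
        (continuous_finsetSum _ fun l _ => ((hB k l).comp continuous_fst).mul (by fun_prop))
    obtain ⟨ε, hε, h⟩ := hK.exists_forall_le' hcont.continuousOn (a := 0) (by
      rintro ⟨x, s⟩ ⟨-, ⟨hs, hsi⟩, hsj⟩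
      simp only [Set.mem_ofPred_eq, mem_univ_pi] at hs hsi hsj
      obtain ⟨k, hk⟩ := exists_pos_of_irreducible (hBc x) (hBi x) (hBd x) (fun k => (hs k).2) hsi
        (hsj.trans_lt one_pos)
      exact Finset.sum_pos' (fun _ _ => le_max_left _ _)
        ⟨k, Finset.mem_univ k, hk.trans_le (le_max_right _ _)⟩)
    exact ⟨ε, hε, fun x s hs hsi hsj => h (x, s) ⟨mem_univ _, ⟨fun k _ => hs k, hsi⟩, hsj⟩⟩
  choose ε hε hkey using key
  -- The sum over all pairs dominates the bound for the pair of extremal indices, which varies with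
  -- `s`.
  refine ⟨∑ i, ∑ j, m * |K| / ε i j, Finset.sum_nonneg fun i _ => Finset.sum_nonneg fun j _ =>
    div_nonneg (by positivity) (hε i j).le, fun x s hs i' j' => ?_⟩
  have : Nonempty (Fin m) := ⟨i'⟩
  obtain ⟨i, hi⟩ := Finite.exists_max s
  obtain ⟨j, hj⟩ := Finite.exists_min s
  have hle : s i' - s j' ≤ s i - s j := by linarith [hi i', hj j']
  refine hle.trans ?_
  have hsum : m * |K| / ε i j ≤ ∑ i, ∑ j, m * |K| / ε i j := by
    refine le_trans ?_ (Finset.single_le_sum (f := fun i => ∑ j, m * |K| / ε i j)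
      (fun i _ => Finset.sum_nonneg fun j _ => div_nonneg (by positivity) (hε i j).le)
      (Finset.mem_univ i))
    exact Finset.single_le_sum (f := fun j => m * |K| / ε i j)
      (fun j _ => div_nonneg (by positivity) (hε i j).le) (Finset.mem_univ j)
  refine le_trans ?_ hsum
  rcases le_or_gt (s i - s j) 0 with h0 | h0
  · exact h0.trans (div_nonneg (by positivity) (hε i j).le)
  have h1 := hkey i j x (fun k => (s k - s j) / (s i - s j))
    (fun k => ⟨div_nonneg (by linarith [hj k]) h0.le, (div_le_one h0).2 (by linarith [hi k])⟩)
    (div_self h0.ne') (by simp)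
  have h2 : ∀ k, max 0 (∑ l, B x k l * ((s l - s j) / (s i - s j))) ≤ |K| / (s i - s j) := by
    intro k
    refine max_le (by positivity) ?_
    have : ∑ l, B x k l * ((s l - s j) / (s i - s j)) = (∑ l, B x k l * s l) / (s i - s j) := by
      rw [sum_mul_eq_sum_mul_sub (hBd x k) s (s j), Finset.sum_div]
      exact Finset.sum_congr rfl fun l _ => by ring
    rw [this]
    gcongr
    exact (hs k).trans (le_abs_self K)
  have h3 : ε i j ≤ m * |K| / (s i - s j) := by
    refine h1.trans ((Finset.sum_le_sum fun k _ => h2 k).trans ?_)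
    simp [mul_div_assoc]
  rw [le_div_iff₀ h0] at h3
  rw [le_div_iff₀ (hε i j)]
  linarith

theorem exists_hamiltonian_lower_bound (hH : ∀ k, IsConvexHamiltonian (H k)) :
    ∃ K, ∀ k x p, -K ≤ H k x p := by
  have key : ∀ k, ∃ K, ∀ x p, -K ≤ H k x p := by
    intro k
    obtain ⟨α, β, hα, -, hαβ⟩ := (hH k).coercive
    obtain ⟨R, hR⟩ := eventually_atTop.1 (hα.eventually (eventually_ge_atTop 0))
    obtain ⟨K, hK⟩ := ((isCompact_univ (X := Torus N)).prod
      (isCompact_closedBall (0 : Euc N) R)).exists_bound_of_continuousOn (hH k).continuous.continuousOn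
    refine ⟨|K|, fun x p => ?_⟩
    rcases le_total ‖p‖ R with h | h
    · have := hK (x, p) ⟨mem_univ _, by simpa using h⟩
      rw [Real.norm_eq_abs] at this
      linarith [(abs_le.1 this).1, le_abs_self K]
    · have h1 := hR ‖p‖₊ (by exact_mod_cast h)
      linarith [(hαβ x p).1, abs_nonneg K]
  choose K hK using key
  refine ⟨∑ k, |K k|, fun k x p => ?_⟩
  have := Finset.single_le_sum (f := fun k => |K k|) (fun _ _ => abs_nonneg _) (Finset.mem_univ k)
  linarith [hK k x p, le_abs_self (K k)]

/-- Uniform a priori bounds for the subsolutions at a given level. -/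
theorem exists_apriori_bound (hH : ∀ k, IsConvexHamiltonian (H k))
    (hB : ∀ i j, Continuous fun x => B x i j) (hBc : ∀ x, IsCoupling (B x))
    (hBi : ∀ x, IsIrreducible (B x)) (hBd : ∀ x, IsDegenerate (B x)) (a : ℝ) :
    ∃ R C, 0 ≤ R ∧ ∀ u, IsSubsolutionWith H B (fun _ _ => a) u →
      (∀ k z w, u k (proj w) - u k (proj z) ≤ R * ‖w - z‖) ∧
        ∀ i j x y, u i x - u j y ≤ C := by
  obtain ⟨K, hK⟩ := exists_hamiltonian_lower_bound hH
  obtain ⟨C₀, hC₀, hosc⟩ := exists_oscillation_bound hB hBc hBi hBd (a + K)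
  have hM : ∃ M, ∀ k j x, |B x k j| ≤ M := by
    choose M hM using fun k j => exists_abs_le (hB k j)
    refine ⟨∑ k, ∑ j, |M k j|, fun k j x => (hM k j x).trans ((le_abs_self _).trans ?_)⟩
    refine le_trans ?_ (Finset.single_le_sum (f := fun i => ∑ j, |M i j|)
      (fun i _ => Finset.sum_nonneg fun j _ => abs_nonneg _) (Finset.mem_univ k))
    exact Finset.single_le_sum (f := fun j => |M k j|) (fun j _ => abs_nonneg _) (Finset.mem_univ j)
  obtain ⟨M, hM⟩ := hM
  obtain ⟨R, hR0, hR⟩ := exists_superjet_bound (B := B) hH (a + m * (M * C₀))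
  obtain ⟨D, hD0, hD⟩ := exists_lift_dist_le N
  refine ⟨R, R * D + C₀, hR0, fun u hu => ?_⟩
  -- Since `H ≥ -K`, the bound holds wherever there is a superjet, and such points are dense.
  have h1 : ∀ k x, couplingTerm B u k x ≤ a + K := by
    intro k x
    obtain ⟨z, rfl⟩ := proj_surjective x
    by_contra! hlt
    have hc := ((continuous_couplingTerm hB hu.1 k).comp continuous_proj).continuousAt.eventually
      (lt_mem_nhds hlt)
    obtain ⟨ε, hε, hb⟩ := Metric.mem_nhds_iff.1 hc
    obtain ⟨w, hw, p, hp⟩ := superjet_nonempty_near ((hu.1 k).comp continuous_proj) z hε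
    have h2 : a + K < couplingTerm B u k (proj w) := hb hw
    linarith [hu.2 k w p hp, hK k (proj w) p]
  have h2 : ∀ x i j, u i x - u j x ≤ C₀ := fun x => hosc x (fun k => u k x) fun k => h1 k x
  -- Once the components differ by at most `C₀`, the coupling term is also bounded from below, which
  -- is what bounds the superjets.
  have h3 : ∀ k x, a - couplingTerm B u k x ≤ a + m * (M * C₀) := by
    intro k x
    have e : couplingTerm B u k x = ∑ j, B x k j * (u j x - u k x) :=
      sum_mul_eq_sum_mul_sub (hBd x k) (fun j => u j x) (u k x)
    have : ∑ j, -(B x k j * (u j x - u k x)) ≤ ∑ _j : Fin m, M * C₀ := by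
      refine Finset.sum_le_sum fun j _ => ?_
      have i1 : |u j x - u k x| ≤ C₀ := abs_le.2 ⟨by linarith [h2 x k j], h2 x j k⟩
      calc -(B x k j * (u j x - u k x)) ≤ |B x k j * (u j x - u k x)| := neg_le_abs _
        _ = |B x k j| * |u j x - u k x| := abs_mul _ _
        _ ≤ M * C₀ := mul_le_mul (hM k j x) i1 (abs_nonneg _) ((abs_nonneg _).trans (hM k j x))
    rw [Finset.sum_neg_distrib, ← e] at this
    simp only [Finset.sum_const, Finset.card_univ, Fintype.card_fin, nsmul_eq_mul] at this
    linarith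
  have h4 := hu.lipschitz hR0 (hR _ u hu h3)
  refine ⟨h4, fun i j x y => ?_⟩
  obtain ⟨z, w, rfl, rfl, hzw⟩ := hD y x
  have := h4 i z w
  have i2 : R * ‖w - z‖ ≤ R * D := mul_le_mul_of_nonneg_left hzw hR0
  linarith [h2 (proj z) i j]

end APriori

/-! ### The Mañé matrix and the critical level. -/

section Mane

variable {N m : ℕ} {H : Fin m → Torus N → Euc N → ℝ} {B : Torus N → Matrix (Fin m) (Fin m) ℝ}

theorem continuous_of_lift_lipschitz {u : Torus N → ℝ} {R : ℝ} (hR : 0 ≤ R)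
    (h : ∀ z w, u (proj w) - u (proj z) ≤ R * ‖w - z‖) : Continuous u := by
  rw [← continuous_comp_proj_iff]
  refine (LipschitzWith.of_dist_le_mul (K := ⟨R, hR⟩) fun z w => ?_).continuous
  rw [Real.dist_eq, dist_eq_norm, abs_sub_le_iff]
  exact ⟨h w z, by rw [norm_sub_rev]; exact h z w⟩

theorem subsolutions_mono {a b : ℝ} (hab : a ≤ b) : subsolutions H B a ⊆ subsolutions H B b :=
  fun _ hu => ⟨hu.1, fun k x p hp => (hu.2 k x p hp).trans hab⟩

theorem subsolutions_exists_apriori_bound (hH : ∀ k, IsConvexHamiltonian (H k))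
    (hB : ∀ i j, Continuous fun x => B x i j) (hBc : ∀ x, IsCoupling (B x))
    (hBi : ∀ x, IsIrreducible (B x)) (hBd : ∀ x, IsDegenerate (B x)) (a : ℝ) :
    ∃ R C, 0 ≤ R ∧ ∀ u ∈ subsolutions H B a,
      (∀ k z w, u k (proj w) - u k (proj z) ≤ R * ‖w - z‖) ∧ ∀ i j x y, u i x - u j y ≤ C := by
  obtain ⟨R, C, hR, h⟩ := exists_apriori_bound hH hB hBc hBi hBd a
  exact ⟨R, C, hR, fun u hu => h u (isSubsolution_iff.1 hu)⟩

/-- The Mañé matrix at an arbitrary level. -/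
noncomputable def maneLevel (H : Fin m → Torus N → Euc N → ℝ)
    (B : Torus N → Matrix (Fin m) (Fin m) ℝ) (a : ℝ) (i : Fin m) (y : Torus N) (k : Fin m)
    (x : Torus N) : ℝ :=
  sSup ((fun v : Fin m → Torus N → ℝ => v k x - v i y) '' subsolutions H B a)

section

variable {a R C : ℝ} (hbd : ∀ u ∈ subsolutions H B a,
      (∀ k z w, u k (proj w) - u k (proj z) ≤ R * ‖w - z‖) ∧ ∀ i j x y, u i x - u j y ≤ C)

include hbd

theorem le_maneLevel {v : Fin m → Torus N → ℝ} (hv : v ∈ subsolutions H B a) (i : Fin m)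
    (y : Torus N) (k : Fin m) (x : Torus N) : v k x - v i y ≤ maneLevel H B a i y k x :=
  le_csSup ⟨C, by rintro _ ⟨u, hu, rfl⟩; exact (hbd u hu).2 k i x y⟩ ⟨v, hv, rfl⟩

end

theorem maneLevel_le {a c : ℝ} (hne : (subsolutions H B a).Nonempty) {i k : Fin m} {x y : Torus N}
    (h : ∀ v ∈ subsolutions H B a, v k x - v i y ≤ c) : maneLevel H B a i y k x ≤ c :=
  csSup_le (hne.image _) (by rintro _ ⟨u, hu, rfl⟩; exact h u hu)

theorem maneLevel_self {a : ℝ} (hne : (subsolutions H B a).Nonempty) (i : Fin m) (y : Torus N) :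
    maneLevel H B a i y i y = 0 := by
  have : (fun v : Fin m → Torus N → ℝ => v i y - v i y) '' subsolutions H B a = {0} := by
    simp only [sub_self]
    exact hne.image_const 0
  rw [maneLevel, this, csSup_singleton]

section

variable {a R C : ℝ} (hbd : ∀ u ∈ subsolutions H B a,
      (∀ k z w, u k (proj w) - u k (proj z) ≤ R * ‖w - z‖) ∧ ∀ i j x y, u i x - u j y ≤ C)
  (hne : (subsolutions H B a).Nonempty)

include hbd hne

theorem neg_const_le_maneLevel (i : Fin m) (y : Torus N) (k : Fin m) (x : Torus N) :
    -C ≤ maneLevel H B a i y k x := by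
  obtain ⟨v, hv⟩ := hne
  linarith [(hbd v hv).2 i k y x, le_maneLevel hbd hv i y k x]

theorem maneLevel_lipschitz (i : Fin m) (y : Torus N) (k : Fin m) (z w : Euc N) :
    maneLevel H B a i y k (proj w) - maneLevel H B a i y k (proj z) ≤ R * ‖w - z‖ := by
  rw [sub_le_iff_le_add]
  refine maneLevel_le hne fun v hv => ?_
  linarith [le_maneLevel hbd hv i y k (proj z), (hbd v hv).1 k z w]

theorem maneLevel_lipschitz_base (i : Fin m) (k : Fin m) (x : Torus N) (z w : Euc N) :
    maneLevel H B a i (proj w) k x - maneLevel H B a i (proj z) k x ≤ R * ‖w - z‖ := by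
  rw [sub_le_iff_le_add]
  refine maneLevel_le hne fun v hv => ?_
  have := (hbd v hv).1 i w z
  rw [norm_sub_rev] at this
  linarith [le_maneLevel hbd hv i (proj z) k x]

/-- The supremum is taken over the subsolutions `v - v_i(y)`: they all lie below it and come
arbitrarily close at any given point, as stability requires. -/
theorem isSubsolutionWith_maneLevel (hH : ∀ k, IsConvexHamiltonian (H k))
    (hB : ∀ i j, Continuous fun x => B x i j) (hBc : ∀ x, IsCoupling (B x))
    (hBd : ∀ x, IsDegenerate (B x)) (hR : 0 ≤ R) (i : Fin m) (y : Torus N) :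
    IsSubsolutionWith H B (fun _ _ => a) (maneLevel H B a i y) := by
  refine isSubsolutionWith_of_approx (fun k => (hH k).continuous) hB hBc
    (fun k => continuous_of_lift_lipschitz hR (maneLevel_lipschitz hbd hne i y k))
    (fun _ => continuous_const) fun k x ε hε => ?_
  obtain ⟨_, ⟨v, hv, rfl⟩, hlt⟩ := exists_lt_of_lt_csSup (hne.image _)
    (show maneLevel H B a i y k x - ε < maneLevel H B a i y k x by linarith)
  refine ⟨fun k x => v k x + -v i y, fun _ _ => a, (isSubsolution_iff.1 hv).add_const hBd _,
    fun j x' => ?_, ?_, fun _ => by linarith⟩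
  · linarith [le_maneLevel hbd hv i y j x']
  · simp only at hlt
    linarith

end

theorem exists_subsolution_of_level_pos (hH : ∀ k, IsConvexHamiltonian (H k))
    (hc : criticalValue H B = 0) {a : ℝ} (ha : 0 < a) : (subsolutions H B a).Nonempty := by
  -- The infimum of the empty set is 0 by convention, so `hc` alone does not exclude emptiness; the
  -- zero function is a subsolution at a high level.
  have hne : {a : ℝ | (subsolutions H B a).Nonempty}.Nonempty := by
    have hM : ∀ k, ∃ M, ∀ x, |H k x 0 + couplingTerm B (fun _ _ => 0) k x| ≤ M := fun k => by
      refine exists_abs_le ?_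
      simp only [couplingTerm, mul_zero, Finset.sum_const_zero, add_zero]
      exact (hH k).continuous.comp (Continuous.prodMk_left 0)
    choose M hM using hM
    refine ⟨∑ k, |M k|, fun _ _ => 0, isSubsolution_iff.2 ⟨fun _ => continuous_const,
      fun k z p hp => ?_⟩⟩
    rw [superjet_eq_of_hasGradientAt hp (hasGradientAt_const z (0 : ℝ))]
    exact (le_abs_self _).trans ((hM k _).trans ((le_abs_self _).trans (Finset.single_le_sum
      (f := fun k => |M k|) (fun _ _ => abs_nonneg _) (Finset.mem_univ k))))
  obtain ⟨b, hb, hba⟩ := exists_lt_of_csInf_lt hne (hc.trans_lt ha)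
  exact hb.mono (subsolutions_mono hba.le)

/-- The critical value is attained. -/
theorem exists_critical_subsolution (hH : ∀ k, IsConvexHamiltonian (H k))
    (hB : ∀ i j, Continuous fun x => B x i j) (hBc : ∀ x, IsCoupling (B x))
    (hBi : ∀ x, IsIrreducible (B x)) (hBd : ∀ x, IsDegenerate (B x))
    (hc : criticalValue H B = 0) (i : Fin m) : (subsolutions H B 0).Nonempty := by
  obtain ⟨R, C, hR, hbd⟩ := subsolutions_exists_apriori_bound hH hB hBc hBi hBd 1
  set a : ℕ → ℝ := fun n => 1 / (n + 1) with ha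
  have ha0 : ∀ n, 0 < a n := fun n => by positivity
  have ha1 : ∀ n, a n ≤ 1 := fun n => by
    rw [ha]; simp only; rw [div_le_one (by positivity)]; linarith [n.cast_nonneg (α := ℝ)]
  have hanti : Antitone a := fun n n' h => by
    simp only [ha]
    exact one_div_le_one_div_of_le (by positivity) (by exact_mod_cast Nat.succ_le_succ h)
  have hbd' : ∀ n, ∀ u ∈ subsolutions H B (a n),
      (∀ k z w, u k (proj w) - u k (proj z) ≤ R * ‖w - z‖) ∧ ∀ i j x y, u i x - u j y ≤ C :=
    fun n u hu => hbd u (subsolutions_mono (ha1 n) hu)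
  have hne : ∀ n, (subsolutions H B (a n)).Nonempty := fun n =>
    exists_subsolution_of_level_pos hH hc (ha0 n)
  -- Mañé functions decrease with the level, so the whole sequence converges pointwise, and
  -- uniformly by Dini's theorem, without extracting subsequences.
  set F : ℕ → Fin m → Torus N → ℝ := fun n => maneLevel H B (a n) i 0 with hF
  have hFanti : ∀ k x, Antitone fun n => F n k x := fun k x n n' h =>
    maneLevel_le (hne n') fun v hv => le_maneLevel (hbd' n) (subsolutions_mono (hanti h) hv) i 0 k x
  have hlim : ∀ k x, Tendsto (fun n => F n k x) atTop (𝓝 (⨅ n, F n k x)) := fun k x =>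
    tendsto_atTop_ciInf (hFanti k x)
      ⟨-C, by rintro _ ⟨n, rfl⟩; exact neg_const_le_maneLevel (hbd' n) (hne n) i 0 k x⟩
  set w : Fin m → Torus N → ℝ := fun k x => ⨅ n, F n k x with hw
  have hwc : ∀ k, Continuous (w k) := fun k => continuous_of_lift_lipschitz hR fun z z' =>
    le_of_tendsto ((hlim k (proj z')).sub (hlim k (proj z))) (Eventually.of_forall fun n =>
      maneLevel_lipschitz (hbd' n) (hne n) i 0 k z z')
  have hFs : ∀ n, IsSubsolutionWith H B (fun _ _ => a n) (F n) := fun n =>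
    isSubsolutionWith_maneLevel (hbd' n) (hne n) hH hB hBc hBd hR i 0
  have hunif : ∀ k, TendstoUniformly (fun n => F n k) (w k) atTop := fun k =>
    Antitone.tendstoUniformly_of_forall_tendsto (fun n => (hFs n).1 k)
      (fun n n' h x => hFanti k x h) (hwc k) (hlim k)
  refine ⟨w, isSubsolution_iff.2 (isSubsolutionWith_of_approx (fun k => (hH k).continuous) hB hBc hwc
    (fun _ => continuous_const) fun k x ε hε => ?_)⟩
  have e1 := eventually_all.2 fun k => Metric.tendstoUniformly_iff.1 (hunif k) ε hε
  have e2 : ∀ᶠ n in atTop, a n < ε :=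
    (tendsto_one_div_add_atTop_nhds_zero_nat (𝕜 := ℝ)).eventually (gt_mem_nhds hε)
  obtain ⟨n, h1, h2⟩ := (e1.and e2).exists
  refine ⟨F n, fun _ _ => a n, hFs n, fun j y => ?_, ?_, fun _ => by linarith⟩
  · have := h1 j y
    rw [Real.dist_eq, abs_lt] at this
    linarith
  · have := h1 k x
    rw [Real.dist_eq, abs_lt] at this
    linarith

/-- The levels admitting subsolutions are bounded from below. -/
theorem bddBelow_levels (hH : ∀ k, IsConvexHamiltonian (H k)) (hBc : ∀ x, IsCoupling (B x))
    (hBd : ∀ x, IsDegenerate (B x)) (i : Fin m) :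
    BddBelow {a : ℝ | (subsolutions H B a).Nonempty} := by
  obtain ⟨K, hK⟩ := exists_hamiltonian_lower_bound hH
  refine ⟨-K, ?_⟩
  rintro a ⟨u, hu⟩
  have hu := isSubsolution_iff.1 hu
  have : Nonempty (Fin m) := ⟨i⟩
  have hx : ∀ k, ∃ x, ∀ y, u k y ≤ u k x := fun k => by
    obtain ⟨x, -, hx⟩ := isCompact_univ.exists_isMaxOn univ_nonempty (hu.1 k).continuousOn
    exact ⟨x, fun y => hx (mem_univ y)⟩
  choose x hx using hx
  -- At a maximum point of the largest component, 0 is a superjet and the coupling term is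
  -- nonnegative.
  obtain ⟨k, hk⟩ := Finite.exists_max fun k => u k (x k)
  obtain ⟨z, hz⟩ := proj_surjective (x k)
  have h0 : (0 : Euc N) ∈ superjet (fun w => u k (proj w)) z :=
    ⟨fun _ => 0, contDiffAt_const, Eventually.of_forall fun w => by
      simpa [hz] using hx k (proj w), hasGradientAt_const z 0⟩
  have h1 := hu.2 k z 0 h0
  rw [hz] at h1
  have h2 : 0 ≤ couplingTerm B u k (x k) := by
    rw [couplingTerm, sum_mul_eq_sum_mul_sub (hBd (x k) k) _ (u k (x k))]
    refine Finset.sum_nonneg fun j _ => ?_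
    rcases eq_or_ne j k with rfl | hjk
    · simp
    · exact mul_nonneg_of_nonpos_of_nonpos ((hBc _).1 k j hjk)
        (sub_nonpos.2 ((hx j (x k)).trans (hk j)))
  linarith [hK k (x k) 0]

end Mane

/-! ### Trigonometric test functions on the torus. -/

section Periodic

variable {N : ℕ}

theorem exists_addCircle_lift {h : ℝ → ℝ} (hp : Function.Periodic h 1) (hc : Continuous h) :
    ∃ h' : UnitAddCircle → ℝ, Continuous h' ∧ ∀ t : ℝ, h' t = h t :=
  ⟨hp.lift, (QuotientAddGroup.isOpenQuotientMap_mk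
    (N := AddSubgroup.zmultiples (1 : ℝ))).continuous_comp_iff.1 hc, hp.lift_coe⟩

theorem hasGradientAt_sum_coord {h h' : Fin N → ℝ → ℝ} {w : Euc N}
    (hd : ∀ j, HasDerivAt (h j) (h' j (w j)) (w j)) :
    HasGradientAt (fun w : Euc N => ∑ j, h j (w j)) (WithLp.toLp 2 fun j => h' j (w j)) w := by
  rw [hasGradientAt_iff_hasFDerivAt]
  have key : HasFDerivAt (fun w : Euc N => ∑ j, h j (w j)) _ w := HasFDerivAt.fun_sum fun j _ =>
    (hd j).comp_hasFDerivAt w (EuclideanSpace.proj (𝕜 := ℝ) j).hasFDerivAt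
  refine key.congr_fderiv ?_
  ext v
  simp [PiLp.inner_apply, mul_comm]

/-- Sums of periodic functions of one coordinate, as functions on the torus. -/
theorem exists_torus_sum {h h' : Fin N → ℝ → ℝ} (hp : ∀ j, Function.Periodic (h j) 1)
    (hp' : ∀ j, Function.Periodic (h' j) 1) (hd : ∀ j t, HasDerivAt (h j) (h' j t) t)
    (hc' : ∀ j, Continuous (h' j)) :
    ∃ (Q : Torus N → ℝ) (g : Torus N → Euc N), Continuous Q ∧ Continuous g ∧
      (∀ w, Q (proj w) = ∑ j, h j (w j)) ∧
      (∀ w, g (proj w) = WithLp.toLp 2 fun j => h' j (w j)) ∧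
      ∀ w, HasGradientAt (fun w => Q (proj w)) (g (proj w)) w := by
  have hc : ∀ j, Continuous (h j) := fun j =>
    continuous_iff_continuousAt.2 fun t => (hd j t).continuousAt
  choose q hqc hq using fun j => exists_addCircle_lift (hp j) (hc j)
  choose q' hqc' hq' using fun j => exists_addCircle_lift (hp' j) (hc' j)
  have e1 : ∀ w : Euc N, ∑ j, q j (proj w j) = ∑ j, h j (w j) := fun w =>
    Finset.sum_congr rfl fun j _ => hq j (w j)
  have e2 : ∀ w : Euc N, (WithLp.toLp 2 fun j => q' j (proj w j) : Euc N) =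
      WithLp.toLp 2 fun j => h' j (w j) := fun w => by
    congr 1; funext j; exact hq' j (w j)
  refine ⟨fun x => ∑ j, q j (x j), fun x => WithLp.toLp 2 fun j => q' j (x j),
    continuous_finsetSum _ fun j _ => (hqc j).comp (continuous_apply j),
    (PiLp.continuous_toLp 2 _).comp (continuous_pi fun j => (hqc' j).comp (continuous_apply j)),
    e1, e2, fun w => ?_⟩
  simp only [e1, e2]
  exact hasGradientAt_sum_coord fun j => hd j (w j)

/-- Functions on the torus with prescribed gradient at a point. -/
theorem exists_torus_linear (z p : Euc N) :
    ∃ (L : Torus N → ℝ) (g : Torus N → Euc N), Continuous L ∧ Continuous g ∧ L (proj z) = 0 ∧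
      g (proj z) = p ∧ ∀ w, HasGradientAt (fun w => L (proj w)) (g (proj w)) w := by
  obtain ⟨L, g, hL, hg, hL', hg', hLg⟩ := exists_torus_sum
    (h := fun j t => p j * (Real.sin (2 * Real.pi * (t - z j)) / (2 * Real.pi)))
    (h' := fun j t => p j * Real.cos (2 * Real.pi * (t - z j)))
    (fun j t => by
      simp only
      rw [show 2 * Real.pi * (t + 1 - z j) = 2 * Real.pi * (t - z j) + 2 * Real.pi by ring,
        Real.sin_add_two_pi])
    (fun j t => by
      simp only
      rw [show 2 * Real.pi * (t + 1 - z j) = 2 * Real.pi * (t - z j) + 2 * Real.pi by ring,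
        Real.cos_add_two_pi])
    (fun j t => by
      have h1 : HasDerivAt (fun t : ℝ => 2 * Real.pi * (t - z j)) (2 * Real.pi) t := by
        simpa using ((hasDerivAt_id t).sub_const (z j)).const_mul (2 * Real.pi)
      refine ((h1.sin.div_const (2 * Real.pi)).const_mul (p j)).congr_deriv ?_
      field_simp)
    (fun j => by fun_prop)
  refine ⟨L, g, hL, hg, by simp [hL'], ?_, hLg⟩
  rw [hg']
  ext j
  simp

/-- A smooth function on the torus that behaves like the squared distance from a point. -/
theorem exists_torus_sq (z : Euc N) :
    ∃ (Q : Torus N → ℝ) (g : Torus N → Euc N), Continuous Q ∧ Continuous g ∧ Q (proj z) = 0 ∧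
      (∀ w, HasGradientAt (fun w => Q (proj w)) (g (proj w)) w) ∧
      ContDiff ℝ 1 (fun w => Q (proj w)) ∧ (∀ w, ‖g (proj w)‖ ≤ 40 * ‖w - z‖) ∧
      ∀ x, ∃ w, proj w = x ∧ 8 * ‖w - z‖ ^ 2 ≤ Q x := by
  obtain ⟨Q, g, hQ, hg, hQ', hg', hQg⟩ := exists_torus_sum
    (h := fun j t => 1 - Real.cos (2 * Real.pi * (t - z j)))
    (h' := fun j t => 2 * Real.pi * Real.sin (2 * Real.pi * (t - z j)))
    (fun j t => by
      simp only
      rw [show 2 * Real.pi * (t + 1 - z j) = 2 * Real.pi * (t - z j) + 2 * Real.pi by ring,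
        Real.cos_add_two_pi])
    (fun j t => by
      simp only
      rw [show 2 * Real.pi * (t + 1 - z j) = 2 * Real.pi * (t - z j) + 2 * Real.pi by ring,
        Real.sin_add_two_pi])
    (fun j t => by
      have h1 : HasDerivAt (fun t : ℝ => 2 * Real.pi * (t - z j)) (2 * Real.pi) t := by
        simpa using ((hasDerivAt_id t).sub_const (z j)).const_mul (2 * Real.pi)
      refine (h1.cos.const_sub 1).congr_deriv ?_
      ring)
    (fun j => by fun_prop)
  have hpi := Real.pi_pos
  -- The derivative `2π sin (2πt)` is at most `4π² |t|` in absolute value; this is the source of the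
  -- constant 40.
  have hpi4 : 4 * Real.pi ^ 2 ≤ 40 := by nlinarith [Real.pi_lt_d2]
  refine ⟨Q, g, hQ, hg, by simp [hQ'], hQg, ?_, fun w => ?_, fun x => ?_⟩
  · simp only [hQ']
    refine ContDiff.sum fun j _ => contDiff_const.sub (Real.contDiff_cos.comp ?_)
    exact contDiff_const.mul ((EuclideanSpace.proj (𝕜 := ℝ) j).contDiff.sub contDiff_const)
  · rw [hg']
    refine le_of_sq_le_sq ?_ (by positivity)
    rw [mul_pow, EuclideanSpace.norm_sq_eq, EuclideanSpace.norm_sq_eq, Finset.mul_sum]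
    refine Finset.sum_le_sum fun j _ => ?_
    simp only [PiLp.sub_apply, Real.norm_eq_abs, ← mul_pow]
    refine pow_le_pow_left₀ (abs_nonneg _) ?_ 2
    calc |2 * Real.pi * Real.sin (2 * Real.pi * (w j - z j))|
        = 2 * Real.pi * |Real.sin (2 * Real.pi * (w j - z j))| := by
          rw [abs_mul, abs_of_pos (by positivity)]
      _ ≤ 2 * Real.pi * |2 * Real.pi * (w j - z j)| := by
          exact mul_le_mul_of_nonneg_left Real.abs_sin_le_abs (by positivity)
      _ = 4 * Real.pi ^ 2 * |w j - z j| := by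
          rw [abs_mul, abs_of_pos (show 0 < 2 * Real.pi by positivity)]; ring
      _ ≤ 40 * |w j - z j| := by gcongr
  · obtain ⟨a, rfl⟩ := proj_surjective x
    -- In this lift each coordinate is within 1/2 of that of `z`, so `1 - cos θ ≥ 2θ²/π²` applies
    -- with `|θ| ≤ π` and yields the factor 8.
    set w : Euc N := WithLp.toLp 2 fun j => a j - round (a j - z j) with hw
    have hwj : ∀ j, w j = a j - round (a j - z j) := fun j => rfl
    have hpw : proj w = proj a := by
      funext j
      change ((w j : ℝ) : UnitAddCircle) = ((a j : ℝ) : UnitAddCircle)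
      rw [hwj, AddCircle.coe_sub, sub_eq_self, AddCircle.coe_eq_zero_iff]
      exact ⟨round (a j - z j), by simp⟩
    refine ⟨w, hpw, ?_⟩
    rw [← hpw, hQ', EuclideanSpace.norm_sq_eq, Finset.mul_sum]
    refine Finset.sum_le_sum fun j _ => ?_
    have h1 : |w j - z j| ≤ 1 / 2 := by
      rw [hwj, show a j - round (a j - z j) - z j = (a j - z j) - round (a j - z j) by ring]
      exact abs_sub_round _
    have h2 := Real.cos_le_one_sub_mul_cos_sq (x := 2 * Real.pi * (w j - z j)) (by
      rw [abs_mul, abs_of_pos (by positivity)]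
      nlinarith)
    have h3 : 2 / Real.pi ^ 2 * (2 * Real.pi * (w j - z j)) ^ 2 = 8 * (w j - z j) ^ 2 := by
      field_simp; norm_num [mul_comm]
    simp only [PiLp.sub_apply, Real.norm_eq_abs, sq_abs]
    linarith

end Periodic

/-! ### Raising a component where the supersolution test fails. -/

section Bump

variable {N m : ℕ} {H : Fin m → Torus N → Euc N → ℝ} {B : Torus N → Matrix (Fin m) (Fin m) ℝ}

theorem couplingTerm_update (u : Fin m → Torus N → ℝ) (k : Fin m) (U : Torus N → ℝ) (l : Fin m)
    (x : Torus N) : couplingTerm B (Function.update u k U) l x =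
      couplingTerm B u l x + B x l k * (U x - u k x) := by
  have h1 : couplingTerm B (Function.update u k U) l x - couplingTerm B u l x =
      ∑ j, B x l j * (Function.update u k U j x - u j x) := by
    simp only [couplingTerm, ← Finset.sum_sub_distrib, mul_sub]
  rw [Finset.sum_eq_single k (fun j _ hj => by simp [hj]) (by simp)] at h1
  simp only [Function.update_self] at h1
  linarith

/-- Raising one component of a subsolution to a strict local subsolution. -/
theorem isSubsolutionWith_update_max {w : Fin m → Torus N → ℝ}
    (hw : IsSubsolutionWith H B (fun _ _ => 0) w) {k : Fin m} {ψ : Torus N → ℝ}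
    {g : Torus N → Euc N} (hψ : Continuous ψ)
    (hg : ∀ z, HasGradientAt (fun z => ψ (proj z)) (g (proj z)) z) {δ : ℝ} (hδ : 0 < δ)
    (hlt : ∀ x, w k x < ψ x →
      H k x (g x) + (couplingTerm B w k x + B x k k * (ψ x - w k x)) ≤ -δ) :
    IsSubsolutionWith H B
      (fun j x => if j = k then -min δ (max (w k x) (ψ x) - w k x)
        else B x j k * (max (w k x) (ψ x) - w k x))
      (Function.update w k fun x => max (w k x) (ψ x)) := by
  constructor
  · intro j
    rcases eq_or_ne j k with rfl | hj
    · rw [Function.update_self]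
      exact (hw.1 j).max hψ
    · rw [Function.update_of_ne hj]
      exact hw.1 j
  · intro j z p hp
    rw [couplingTerm_update]
    rcases eq_or_ne j k with rfl | hj
    · simp only [Function.update_self, if_true] at hp ⊢
      -- A superjet of a maximum is a superjet of whichever function realizes it.
      rcases le_or_gt (ψ (proj z)) (w j (proj z)) with h | h
      · have h1 := hw.2 j z p (superjet_of_le (V := fun z => max (w j (proj z)) (ψ (proj z)))
          (Eventually.of_forall fun _ => le_max_left _ _) (max_eq_left h).symm hp)
        rw [max_eq_left h]
        simp [hδ.le]
        linarith
      · have h1 := superjet_of_le (U := fun z => ψ (proj z)) (V := fun z => max (w j (proj z)) (ψ (proj z)))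
          (Eventually.of_forall fun _ => le_max_right _ _) (max_eq_right h.le).symm hp
        rw [superjet_eq_of_hasGradientAt h1 (hg z), max_eq_right h.le]
        have := hlt (proj z) h
        linarith [min_le_left δ (ψ (proj z) - w j (proj z))]
    · rw [Function.update_of_ne hj] at hp
      have := hw.2 j z p hp
      simp only [if_neg hj]
      linarith

/-- The strict inequality persists for nearby points, momenta and values. The function `ψ` is the
first-order part of `w k` at `x₀`, bent down by a multiple of `Q` and lifted by `ε`, so that it
exceeds `w k` only close to `x₀`. -/
theorem exists_local_raise (hH : ∀ k, IsConvexHamiltonian (H k))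
    (hB : ∀ i j, Continuous fun x => B x i j) {w : Fin m → Torus N → ℝ}
    (hw : ∀ k, Continuous (w k)) {k : Fin m} {x₀ : Torus N} {p : Euc N}
    (hp : p ∈ subdifferential (w k) x₀) (hlt : H k x₀ p + couplingTerm B w k x₀ < 0)
    {O : Set (Torus N)} (hO : O ∈ 𝓝 x₀) :
    ∃ (ψ : Torus N → ℝ) (g : Torus N → Euc N) (δ : ℝ), Continuous ψ ∧ 0 < δ ∧
      (∀ z, HasGradientAt (fun z => ψ (proj z)) (g (proj z)) z) ∧ w k x₀ < ψ x₀ ∧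
      ∀ x, w k x < ψ x → x ∈ O ∧
        H k x (g x) + (couplingTerm B w k x + B x k k * (ψ x - w k x)) ≤ -δ := by
  obtain ⟨z, φ, rfl, -, hmin, hφ⟩ := hp
  obtain ⟨δ, hδ, hlt⟩ : ∃ δ > 0, H k (proj z) p + couplingTerm B w k (proj z) < -δ :=
    ⟨-(H k (proj z) p + couplingTerm B w k (proj z)) / 2, by linarith, by linarith⟩
  have hF : Continuous fun a : Torus N × Euc N × ℝ =>
      H k a.1 a.2.1 + (couplingTerm B w k a.1 + B a.1 k k * (a.2.2 - w k a.1)) := by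
    have i1 : Continuous fun a : Torus N × Euc N × ℝ => H k a.1 a.2.1 :=
      (hH k).continuous.comp (continuous_fst.prodMk (by fun_prop))
    have i2 := (continuous_couplingTerm hB hw k).comp (continuous_fst (X := Torus N) (Y := Euc N × ℝ))
    have i3 := (hB k k).comp (continuous_fst (X := Torus N) (Y := Euc N × ℝ))
    have i4 := (hw k).comp (continuous_fst (X := Torus N) (Y := Euc N × ℝ))
    exact i1.add (i2.add (i3.mul (Continuous.sub (by fun_prop) i4)))
  have hev := (hF.continuousAt (x := (proj z, p, w k (proj z)))).eventually
    (gt_mem_nhds (show _ < -δ by simpa using hlt))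
  rw [nhds_prod_eq, nhds_prod_eq] at hev
  obtain ⟨V, hV, P, hP, hVP⟩ := eventually_prod_iff.1 hev
  obtain ⟨V₂, hV₂, V₃, hV₃, hP'⟩ := eventually_prod_iff.1 hP
  obtain ⟨r₂, hr₂, hb₂⟩ := Metric.mem_nhds_iff.1 hV₂
  obtain ⟨r₃, hr₃, hb₃⟩ := Metric.mem_nhds_iff.1 hV₃
  obtain ⟨r, hr, hrr₂, hrr₃⟩ : ∃ r > 0, r ≤ r₂ ∧ r ≤ r₃ :=
    ⟨min r₂ r₃, lt_min hr₂ hr₃, min_le_left _ _, min_le_right _ _⟩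
  obtain ⟨L, gL, hL, hgL, hL0, hgL0, hLg⟩ := exists_torus_linear z p
  obtain ⟨Q, gQ, hQ, hgQ, hQ0, hQg, -, hgQb, hQl⟩ := exists_torus_sq z
  -- The bending changes the gradient by at most `40 * η < r / 2` within distance `s`.
  set η := r / 100 with hη
  have hη0 : 0 < η := by positivity
  -- the local conditions around `z`
  have c1 : ∀ᶠ y in 𝓝 z, V (proj y) ∧ proj y ∈ O :=
    continuous_proj.continuousAt.eventually (hV.and hO)
  have c2 : ∀ᶠ y in 𝓝 z, w k (proj z) - r < w k (proj y) :=
    ((hw k).comp continuous_proj).continuousAt.eventually (lt_mem_nhds (by simp [hr]))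
  have c3 : ∀ᶠ y in 𝓝 z, dist (L (proj y)) 0 < r / 2 := by
    have := Metric.tendsto_nhds.1 ((hL.comp continuous_proj).continuousAt (x := z)) (r / 2) (by positivity)
    simpa only [Function.comp, hL0] using this
  have c4 : ∀ᶠ y in 𝓝 z, dist (gL (proj y)) p < r / 2 := by
    have := Metric.tendsto_nhds.1 ((hgL.comp continuous_proj).continuousAt (x := z)) (r / 2) (by positivity)
    simpa only [Function.comp, hgL0] using this
  have c5 : ∀ᶠ y in 𝓝 z, -(η * ‖y - z‖) ≤ w k (proj y) - w k (proj z) - L (proj y) := by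
    have hgrad := hasGradientAt_sub hφ (hLg z)
    rw [hgL0, sub_self] at hgrad
    filter_upwards [(hasGradientAt_iff_isLittleO.1 hgrad).def hη0, hmin] with y h1 h2
    simp only [inner_zero_left, sub_zero, hL0, Real.norm_eq_abs] at h1
    linarith [(abs_le.1 h1).1]
  obtain ⟨ρ, hρ, hball⟩ := Metric.mem_nhds_iff.1 (c1.and (c2.and (c3.and (c4.and c5))))
  obtain ⟨M, hM⟩ := exists_abs_le (show Continuous fun x => w k x - w k (proj z) - L x from
    ((hw k).sub continuous_const).sub hL)
  have hM0 : 0 ≤ M := (abs_nonneg _).trans (hM 0)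
  -- A sharp enough bending keeps `ψ` below `w k` outside the ball of radius `ρ`, whatever the lift
  -- `ε ≤ 1`.
  obtain ⟨s, hs, hsρ, hsM⟩ : ∃ s > 0, s ≤ ρ ∧ M + 1 ≤ η / s * (8 * ρ ^ 2) := by
    have h0 : 0 < η * (8 * ρ ^ 2) / (M + 1) := by positivity
    refine ⟨min ρ (η * (8 * ρ ^ 2) / (M + 1)), lt_min hρ h0, min_le_left _ _, ?_⟩
    have h1 := min_le_right ρ (η * (8 * ρ ^ 2) / (M + 1))
    have h2 : 0 < min ρ (η * (8 * ρ ^ 2) / (M + 1)) := lt_min hρ h0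
    rw [div_mul_eq_mul_div, le_div_iff₀ h2, mul_comm, ← le_div_iff₀ (by positivity)]
    exact h1
  -- Between distances `s` and `ρ` the bending is at least `8 * η * ‖y - z‖` and the first-order
  -- error at most `η * ‖y - z‖`, which leaves `7 * η * s` for the lift.
  obtain ⟨ε, hε, hε1, hεr, hεs⟩ : ∃ ε > 0, ε ≤ 1 ∧ ε ≤ r / 2 ∧ ε ≤ 7 * η * s :=
    ⟨min 1 (min (r / 2) (7 * η * s)), by positivity, min_le_left _ _,
      (min_le_right _ _).trans (min_le_left _ _), (min_le_right _ _).trans (min_le_right _ _)⟩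
  have hηs : 0 < η / s := by positivity
  refine ⟨fun x => w k (proj z) + L x - η / s * Q x + ε, fun x => gL x - (η / s) • gQ x, δ,
    by fun_prop, hδ, fun y => ?_, by simp [hL0, hQ0, hε], fun x hx => ?_⟩
  · refine hasGradientAt_add_const (hasGradientAt_sub ?_ (hasGradientAt_const_mul _ (hQg y))) _
    simpa only [add_comm] using hasGradientAt_add_const (hLg y) (w k (proj z))
  simp only at hx
  obtain ⟨y, rfl, hy⟩ := hQl x
  have hQy : η / s * (8 * ‖y - z‖ ^ 2) ≤ η / s * Q (proj y) := mul_le_mul_of_nonneg_left hy hηs.le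
  have hyρ : ‖y - z‖ < ρ := by
    by_contra! h
    have h1 : η / s * (8 * ρ ^ 2) ≤ η / s * (8 * ‖y - z‖ ^ 2) := by gcongr
    linarith [(abs_le.1 (hM (proj y))).1]
  obtain ⟨⟨d1, d1'⟩, d2, d3, d4, d5⟩ := hball (show y ∈ Metric.ball z ρ by
    rwa [Metric.mem_ball, dist_eq_norm])
  have hys : ‖y - z‖ < s := by
    by_contra! h
    have h1 : η / s * (8 * ‖y - z‖ ^ 2) ≥ 8 * η * ‖y - z‖ := by
      have : η / s * s = η := by field_simp
      have h2 : η / s * s * (8 * ‖y - z‖) ≤ η / s * ‖y - z‖ * (8 * ‖y - z‖) := by gcongr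
      rw [this] at h2
      nlinarith
    have h3 : 7 * η * s ≤ 7 * η * ‖y - z‖ := by gcongr
    linarith
  rw [Real.dist_eq, sub_zero, abs_lt] at d3
  have hQ0' : 0 ≤ η / s * Q (proj y) := le_trans (by positivity) hQy
  refine ⟨d1', (hVP d1 (hP' (hb₂ ?_) (hb₃ ?_))).le⟩
  · refine Metric.ball_subset_ball hrr₂ ?_
    rw [Metric.mem_ball, dist_eq_norm]
    have h1 : ‖(η / s) • gQ (proj y)‖ ≤ 40 * η := by
      rw [norm_smul, Real.norm_of_nonneg hηs.le]
      calc η / s * ‖gQ (proj y)‖ ≤ η / s * (40 * s) := by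
            gcongr; exact (hgQb y).trans (by gcongr)
        _ = 40 * η := by field_simp
    calc ‖gL (proj y) - (η / s) • gQ (proj y) - p‖
        = ‖(gL (proj y) - p) - (η / s) • gQ (proj y)‖ := by congr 1; abel
      _ ≤ ‖gL (proj y) - p‖ + ‖(η / s) • gQ (proj y)‖ := norm_sub_le _ _
      _ < r := by rw [← dist_eq_norm]; linarith
  · refine Metric.ball_subset_ball hrr₃ ?_
    rw [Metric.mem_ball, Real.dist_eq, abs_lt]
    constructor <;> linarith

end Bump

/-! ### Creating strictness and spreading it through the coupling. -/

section Strict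

variable {N m : ℕ} {H : Fin m → Torus N → Euc N → ℝ} {B : Torus N → Matrix (Fin m) (Fin m) ℝ}

/-- `v` is a subsolution of the critical system with continuous nonpositive right-hand side `f`. -/
def IsReinforcedSubsolution (H : Fin m → Torus N → Euc N → ℝ)
    (B : Torus N → Matrix (Fin m) (Fin m) ℝ) (f v : Fin m → Torus N → ℝ) : Prop :=
  IsSubsolutionWith H B f v ∧ (∀ k, Continuous (f k)) ∧ ∀ k x, f k x ≤ 0

theorem IsReinforcedSubsolution.mem {f v : Fin m → Torus N → ℝ}
    (h : IsReinforcedSubsolution H B f v) : v ∈ subsolutions H B 0 :=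
  isSubsolution_iff.2 (h.1.mono h.2.2)

/-- The raised function gains strictness at `x₀` but is unchanged in the other components and
outside `O`. This locality is what will contradict the maximality of the Mañé function. -/
theorem exists_strict_component (hH : ∀ k, IsConvexHamiltonian (H k))
    (hB : ∀ i j, Continuous fun x => B x i j) (hBc : ∀ x, IsCoupling (B x))
    {w : Fin m → Torus N → ℝ} (hw : IsSubsolutionWith H B (fun _ _ => 0) w) {k : Fin m}
    {x₀ : Torus N} {p : Euc N} (hp : p ∈ subdifferential (w k) x₀)
    (hlt : H k x₀ p + couplingTerm B w k x₀ < 0) {O : Set (Torus N)} (hO : O ∈ 𝓝 x₀) :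
    ∃ w' f, IsReinforcedSubsolution H B f w' ∧ f k x₀ < 0 ∧ (∀ j, j ≠ k → w' j = w j) ∧
      w k x₀ < w' k x₀ ∧ ∀ x ∉ O, w' k x = w k x := by
  obtain ⟨ψ, g, δ, hψ, hδ, hg, hψ₀, h⟩ := exists_local_raise hH hB hw.1 hp hlt hO
  refine ⟨_, _, ⟨isSubsolutionWith_update_max hw hψ hg hδ fun x hx => (h x hx).2, fun j => ?_,
    fun j x => ?_⟩, ?_, fun j hj => Function.update_of_ne hj _ _, ?_, fun x hx => ?_⟩
  · rcases eq_or_ne j k with rfl | hj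
    · simp only [if_true]
      exact (continuous_const.min (((hw.1 j).max hψ).sub (hw.1 j))).neg
    · simp only [if_neg hj]
      exact (hB j k).mul (((hw.1 k).max hψ).sub (hw.1 k))
  · have h0 : 0 ≤ max (w k x) (ψ x) - w k x := sub_nonneg.2 (le_max_left _ _)
    rcases eq_or_ne j k with rfl | hj
    · simp only [if_true]
      exact neg_nonpos.2 (le_min hδ.le h0)
    · simp only [if_neg hj]
      exact mul_nonpos_of_nonpos_of_nonneg ((hBc x).1 j k hj.symm) h0
  · simp only [if_true]
    rw [max_eq_right hψ₀.le]
    exact neg_neg_of_pos (lt_min hδ (sub_pos.2 hψ₀))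
  · rw [Function.update_self]
    exact hψ₀.trans_le (le_max_right _ _)
  · rw [Function.update_self]
    exact max_eq_left (not_lt.1 fun hlt => hx (h x hlt).1)

/-- `C¹` bumps on the torus. -/
theorem exists_torus_bump {x₀ : Torus N} {O : Set (Torus N)} (hO : O ∈ 𝓝 x₀) :
    ∃ (ψ : Torus N → ℝ) (g : Torus N → Euc N), Continuous ψ ∧ Continuous g ∧
      ContDiff ℝ 1 (fun z => ψ (proj z)) ∧
      (∀ z, HasGradientAt (fun z => ψ (proj z)) (g (proj z)) z) ∧ 0 < ψ x₀ ∧ (∀ x, 0 ≤ ψ x) ∧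
      ∀ x ∉ O, ψ x = 0 ∧ g x = 0 := by
  obtain ⟨z, rfl⟩ := proj_surjective x₀
  obtain ⟨Q, gQ, hQ, hgQ, hQ0, hQg, hQd, -, hQl⟩ := exists_torus_sq z
  obtain ⟨r, hr, hball⟩ := Metric.mem_nhds_iff.1 (continuous_proj.continuousAt.preimage_mem_nhds hO)
  set σ := Real.smoothTransition
  have hσ : ContDiff ℝ 1 σ := Real.smoothTransition.contDiff (n := 1)
  have hσd : ∀ t, HasDerivAt σ (deriv σ t) t := fun t =>
    (hσ.differentiable (by simp) t).hasDerivAt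
  -- Every such `t`, the endpoint 0 included, is a minimum point of `σ`.
  have hσ0 : ∀ t ≤ 0, deriv σ t = 0 := fun t ht => by
    have : IsLocalMin σ t := Eventually.of_forall fun s => by
      rw [show σ t = 0 from Real.smoothTransition.zero_of_nonpos ht]
      exact Real.smoothTransition.nonneg s
    exact this.deriv_eq_zero
  refine ⟨fun x => σ (8 * r ^ 2 - Q x), fun x => deriv σ (8 * r ^ 2 - Q x) • -gQ x,
    hσ.continuous.comp (by fun_prop), ?_, hσ.comp (contDiff_const.sub hQd), fun y => ?_, ?_,
    fun x => Real.smoothTransition.nonneg _, fun x hx => ?_⟩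
  · exact ((hσ.continuous_deriv le_rfl).comp (continuous_const.sub hQ)).smul hgQ.neg
  · rw [hasGradientAt_iff_hasFDerivAt]
    have h1 := hasGradientAt_iff_hasFDerivAt.1
      (hasGradientAt_sub (hasGradientAt_const y (8 * r ^ 2)) (hQg y))
    have h2 : HasFDerivAt (fun y => σ (8 * r ^ 2 - Q (proj y))) _ y :=
      HasDerivAt.comp_hasFDerivAt (h₂ := σ) (f := fun y => 8 * r ^ 2 - Q (proj y)) y (hσd _) h1
    refine h2.congr_fderiv ?_
    ext v
    simp
  · simp only [hQ0, sub_zero]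
    exact Real.smoothTransition.pos_of_pos (by positivity)
  · have hle : 8 * r ^ 2 - Q x ≤ 0 := by
      obtain ⟨y, rfl, hy⟩ := hQl x
      have hry : r ≤ ‖y - z‖ := by
        by_contra! hlt
        exact hx (hball (show y ∈ Metric.ball z r by rwa [Metric.mem_ball, dist_eq_norm]))
      have : 8 * r ^ 2 ≤ 8 * ‖y - z‖ ^ 2 := by gcongr
      linarith
    exact ⟨Real.smoothTransition.zero_of_nonpos hle, by simp [hσ0 _ hle]⟩

/-- Strictness of a component propagates along the coupling. -/
theorem IsReinforcedSubsolution.spread (hH : ∀ k, IsConvexHamiltonian (H k))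
    (hB : ∀ i j, Continuous fun x => B x i j) (hBc : ∀ x, IsCoupling (B x))
    {f v : Fin m → Torus N → ℝ} (h : IsReinforcedSubsolution H B f v) {j : Fin m} {y : Torus N}
    (hj : f j y < 0) :
    ∃ f' v', IsReinforcedSubsolution H B f' v' ∧ (∀ l, f l y < 0 → f' l y < 0) ∧
      ∀ l, B y l j ≠ 0 → f' l y < 0 := by
  obtain ⟨δ, hδ, hjδ⟩ : ∃ δ > 0, f j y < -δ := ⟨-f j y / 2, by linarith, by linarith⟩
  obtain ⟨ψ, g, hψ, hg, hψd, hψg, hψ₀, hψ0, hsupp⟩ := exists_torus_bump (O := {x | f j x < -δ})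
    ((h.2.1 j).continuousAt.eventually (gt_mem_nhds hjδ))
  obtain ⟨R, -, hR⟩ := h.1.exists_superjet_bound hH hB h.2.1
  have hcont : Continuous fun a : ℝ × (Torus N × Euc N) =>
      H j a.2.1 (a.2.2 + a.1 • g a.2.1) + B a.2.1 j j * (a.1 * ψ a.2.1) - H j a.2.1 a.2.2 := by
    have hx : Continuous fun a : ℝ × (Torus N × Euc N) => a.2.1 := by fun_prop
    have i1 : Continuous fun a : ℝ × (Torus N × Euc N) => H j a.2.1 (a.2.2 + a.1 • g a.2.1) :=
      (hH j).continuous.comp (hx.prodMk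
        (show Continuous fun a : ℝ × (Torus N × Euc N) => a.2.2 + a.1 • g a.2.1 by fun_prop))
    have i2 : Continuous fun a : ℝ × (Torus N × Euc N) => H j a.2.1 a.2.2 :=
      (hH j).continuous.comp (hx.prodMk (by fun_prop))
    have i3 : Continuous fun a : ℝ × (Torus N × Euc N) => B a.2.1 j j := (hB j j).comp hx
    exact (i1.add (i3.mul (by fun_prop))).sub i2
  -- Raising `v j` by `ε * ψ` costs less than `δ / 2` in equation `j`, which has a margin `δ` on the
  -- support of `ψ`. Every other equation `l` gains `B l j * (ε * ψ) ≤ 0`, strictly at `y` when `B y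
  -- l j ≠ 0`.
  have hev : ∀ᶠ ε : ℝ in 𝓝 0, ∀ a ∈ (univ : Set (Torus N)) ×ˢ Metric.closedBall (0 : Euc N) R,
      H j a.1 (a.2 + ε • g a.1) + B a.1 j j * (ε * ψ a.1) - H j a.1 a.2 < δ / 2 := by
    refine (isCompact_univ.prod (isCompact_closedBall _ _)).eventually_forall_of_forall_eventually
      fun a _ => ?_
    exact (hcont.continuousAt (x := ((0 : ℝ), a))).eventually
      (gt_mem_nhds (show _ < δ / 2 by simpa using hδ))
  obtain ⟨ε, hε, hε0⟩ := ((hev.filter_mono nhdsWithin_le_nhds).and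
    (self_mem_nhdsWithin (a := (0 : ℝ)) (s := Ioi 0))).exists
  have hsub : ∀ x, v j x + ε * ψ x - v j x = ε * ψ x := fun x => by ring
  refine ⟨fun l x => if l = j then max (f j x) (-(δ / 2)) else f l x + B x l j * (ε * ψ x),
    Function.update v j fun x => v j x + ε * ψ x, ⟨⟨fun l => ?_, fun l z p hp => ?_⟩, fun l => ?_,
      fun l x => ?_⟩, fun l hl => ?_, fun l hl => ?_⟩
  · rcases eq_or_ne l j with rfl | hlj
    · rw [Function.update_self]
      exact (h.1.1 l).add (continuous_const.mul hψ)
    · rw [Function.update_of_ne hlj]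
      exact h.1.1 l
  · rw [couplingTerm_update]
    simp only [hsub]
    rcases eq_or_ne l j with rfl | hlj
    · simp only [Function.update_self, if_true] at hp ⊢
      have hq := superjet_add_contDiff (U := fun w => v l (proj w)) (ψ := fun w => ε * ψ (proj w))
        (contDiff_const.mul hψd).contDiffAt (hasGradientAt_const_mul ε (hψg z)) hp
      have h1 := h.1.2 l z _ hq
      by_cases hz : proj z ∈ {x | f l x < -δ}
      · have h2 := hε (proj z, p - ε • g (proj z)) ⟨mem_univ _, by simpa using hR l z _ hq⟩
        simp only [sub_add_cancel] at h2
        have h3 : f l (proj z) < -δ := hz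
        exact le_trans (by linarith) (le_max_right _ _)
      · obtain ⟨h2, h3⟩ := hsupp _ hz
        rw [h3, smul_zero, sub_zero] at h1
        rw [h2]
        exact le_trans (by linarith) (le_max_left _ _)
    · rw [Function.update_of_ne hlj] at hp
      have := h.1.2 l z p hp
      simp only [if_neg hlj]
      linarith
  · rcases eq_or_ne l j with rfl | hlj
    · simp only [if_true]
      exact (h.2.1 l).max continuous_const
    · simp only [if_neg hlj]
      exact (h.2.1 l).add ((hB l j).mul (continuous_const.mul hψ))
  · rcases eq_or_ne l j with rfl | hlj
    · simp only [if_true]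
      exact max_le (h.2.2 l x) (by linarith)
    · simp only [if_neg hlj]
      exact add_nonpos (h.2.2 l x) (mul_nonpos_of_nonpos_of_nonneg ((hBc x).1 l j hlj.symm)
        (mul_nonneg hε0.le (hψ0 x)))
  · rcases eq_or_ne l j with rfl | hlj
    · simp only [if_true]
      exact max_lt hl (by linarith)
    · simp only [if_neg hlj]
      exact add_neg_of_neg_of_nonpos hl (mul_nonpos_of_nonpos_of_nonneg
        ((hBc y).1 l j hlj.symm) (mul_nonneg hε0.le (hψ0 y)))
  · rcases eq_or_ne l j with rfl | hlj
    · simp only [if_true]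
      exact max_lt hj (by linarith)
    · simp only [if_neg hlj]
      exact add_neg_of_nonpos_of_neg (h.2.2 l y) (mul_neg_of_neg_of_pos
        (lt_of_le_of_ne ((hBc y).1 l j hlj.symm) hl) (mul_pos hε0 hψ₀))

/-- Induction on the number of components not yet strict at `y`: irreducibility applied to this set
of indices couples one of them to a strict component, and `spread` removes it. -/
theorem IsReinforcedSubsolution.exists_strict (hH : ∀ k, IsConvexHamiltonian (H k))
    (hB : ∀ i j, Continuous fun x => B x i j) (hBc : ∀ x, IsCoupling (B x))
    {y : Torus N} (hBi : IsIrreducible (B y)) {i : Fin m} (n : ℕ) :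
    ∀ f v : Fin m → Torus N → ℝ, IsReinforcedSubsolution H B f v → f i y < 0 →
      (Finset.univ.filter fun k => ¬ f k y < 0).card ≤ n →
      ∃ f' v', IsReinforcedSubsolution H B f' v' ∧ ∀ k, f' k y < 0 := by
  induction n with
  | zero =>
    intro f v h _ hcard
    refine ⟨f, v, h, fun k => ?_⟩
    by_contra hk
    have : k ∈ Finset.univ.filter fun k => ¬ f k y < 0 := by simpa using hk
    rw [Finset.card_eq_zero.1 (Nat.le_zero.1 hcard)] at this
    simp at this
  | succ n ih =>
    intro f v h hi hcard
    by_cases hall : ∀ k, f k y < 0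
    · exact ⟨f, v, h, hall⟩
    push Not at hall
    obtain ⟨k, hk⟩ := hall
    obtain ⟨l, hl, j, hj, hlj⟩ := hBi {k | ¬ f k y < 0} ⟨k, not_lt.2 hk⟩ fun hu =>
      absurd hi (show i ∈ {k | ¬ f k y < 0} from hu ▸ mem_univ i)
    obtain ⟨f', v', h', h1, h2⟩ := h.spread hH hB hBc (not_not.1 hj)
    refine ih f' v' h' (h1 i hi) (Nat.le_of_lt_succ (lt_of_lt_of_le (Finset.card_lt_card ?_) hcard))
    rw [Finset.ssubset_iff_of_subset]
    · exact ⟨l, by simpa using hl, by simpa using h2 l hlj⟩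
    · intro a ha
      simp only [Finset.mem_filter, Finset.mem_univ, true_and] at ha ⊢
      exact fun hlt => ha (h1 a hlt)

end Strict

/-! ### Countable combinations and the Aubry set. -/

section Main

/-- Infinite convex combinations stay in closed convex sets. -/
theorem exists_hasSum_mem_of_isClosed_convex {X : Type*} [NormedAddCommGroup X] [NormedSpace ℝ X]
    [CompleteSpace X] {S : Set X} (hS : IsClosed S) (hconv : Convex ℝ S) {x : ℕ → X}
    (hx : ∀ n, x n ∈ S) {K : ℝ} (hK : ∀ n, ‖x n‖ ≤ K) :
    ∃ s ∈ S, HasSum (fun n => (1 / 2 : ℝ) ^ (n + 1) • x n) s := by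
  have hsum : Summable fun n => (1 / 2 : ℝ) ^ (n + 1) • x n := by
    refine Summable.of_norm_bounded (g := fun n => (1 / 2 : ℝ) ^ (n + 1) * K) ?_ fun n => ?_
    · exact ((summable_nat_add_iff 1).2 (summable_geometric_of_lt_one (by norm_num)
        (by norm_num))).mul_right K
    · rw [norm_smul, Real.norm_of_nonneg (by positivity)]
      gcongr
      exact hK n
  refine ⟨_, ?_, hsum.hasSum⟩
  -- The missing mass of the partial sum is placed on `x 0`, which gives a true convex combination.
  have hpart : ∀ n, ∑ k ∈ Finset.range n, (1 / 2 : ℝ) ^ (k + 1) • x k + (1 / 2 : ℝ) ^ n • x 0 ∈ S := by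
    have hw : ∀ n, ∑ k ∈ Finset.range n, (1 / 2 : ℝ) ^ (k + 1) + (1 / 2 : ℝ) ^ n = 1 := fun n => by
      induction n with
      | zero => simp
      | succ n ih => rw [Finset.sum_range_succ]; linarith [pow_succ (1 / 2 : ℝ) n]
    intro n
    have := hconv.sum_mem (t := Finset.range (n + 1))
      (w := fun k => if k = n then (1 / 2 : ℝ) ^ n else (1 / 2 : ℝ) ^ (k + 1))
      (z := fun k => if k = n then x 0 else x k)
      (fun k _ => by split_ifs <;> positivity)
      (by
        rw [Finset.sum_range_succ, if_pos rfl]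
        refine Eq.trans (congrArg (· + _) ?_) (hw n)
        exact Finset.sum_congr rfl fun k hk => if_neg (Finset.mem_range.1 hk).ne)
      (fun k _ => by split_ifs; exacts [hx 0, hx k])
    rw [Finset.sum_range_succ, if_pos rfl, if_pos rfl] at this
    convert this using 2
    exact Finset.sum_congr rfl fun k hk => by
      rw [if_neg (Finset.mem_range.1 hk).ne, if_neg (Finset.mem_range.1 hk).ne]
  have hlim : Tendsto (fun n => ∑ k ∈ Finset.range n, (1 / 2 : ℝ) ^ (k + 1) • x k +
      (1 / 2 : ℝ) ^ n • x 0) atTop (𝓝 (∑' n, (1 / 2 : ℝ) ^ (n + 1) • x n + (0 : ℝ) • x 0)) :=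
    hsum.hasSum.tendsto_sum_nat.add
      ((tendsto_pow_atTop_nhds_zero_of_lt_one (by norm_num) (by norm_num)).smul_const _)
  rw [zero_smul, add_zero] at hlim
  exact hS.mem_of_tendsto hlim (Eventually.of_forall hpart)

variable {N m : ℕ} {H : Fin m → Torus N → Euc N → ℝ} {B : Torus N → Matrix (Fin m) (Fin m) ℝ}

/-- The reinforced subsolutions, together with their right-hand sides, as a subset of a Banach
space. -/
def reinforcedSet (H : Fin m → Torus N → Euc N → ℝ) (B : Torus N → Matrix (Fin m) (Fin m) ℝ) :
    Set ((Fin m → C(Torus N, ℝ)) × (Fin m → C(Torus N, ℝ))) :=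
  {a | IsReinforcedSubsolution H B (fun k x => a.2 k x) (fun k x => a.1 k x)}

theorem convex_reinforcedSet (hH : ∀ k, IsConvexHamiltonian (H k))
    (hB : ∀ i j, Continuous fun x => B x i j) : Convex ℝ (reinforcedSet H B) := by
  rw [convex_iff_forall_pos]
  intro a ha b hb s t hs ht hst
  obtain rfl : t = 1 - s := by linarith
  refine ⟨?_, fun k => ContinuousMap.continuous _, fun k x => ?_⟩
  · exact ha.1.combo hH hB ha.2.1 hb.2.1 hb.1 hs (by linarith)
  · have h1 := mul_nonpos_of_nonneg_of_nonpos hs.le (ha.2.2 k x)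
    have h2 := mul_nonpos_of_nonneg_of_nonpos ht.le (hb.2.2 k x)
    exact add_nonpos h1 h2

theorem isClosed_reinforcedSet (hH : ∀ k, IsConvexHamiltonian (H k))
    (hB : ∀ i j, Continuous fun x => B x i j) (hBc : ∀ x, IsCoupling (B x)) :
    IsClosed (reinforcedSet H B) := by
  refine isClosed_of_closure_subset fun a ha => ?_
  rw [Metric.mem_closure_iff] at ha
  have happ : ∀ ε > 0, ∃ b ∈ reinforcedSet H B, ∀ k x, |a.1 k x - b.1 k x| < ε ∧
      |a.2 k x - b.2 k x| < ε := fun ε hε => by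
    obtain ⟨b, hb, hab⟩ := ha ε hε
    rw [Prod.dist_eq, max_lt_iff] at hab
    refine ⟨b, hb, fun k x => ⟨?_, ?_⟩⟩
    · exact ((ContinuousMap.dist_apply_le_dist x).trans (dist_le_pi_dist a.1 b.1 k)).trans_lt hab.1
    · exact ((ContinuousMap.dist_apply_le_dist x).trans (dist_le_pi_dist a.2 b.2 k)).trans_lt hab.2
  refine ⟨isSubsolutionWith_of_approx (fun k => (hH k).continuous) hB hBc
    (fun k => (a.1 k).continuous) (fun k => (a.2 k).continuous) fun k x ε hε => ?_,
    fun k => (a.2 k).continuous, fun k x => le_of_forall_pos_le_add fun ε hε => ?_⟩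
  · obtain ⟨b, hb, hab⟩ := happ ε hε
    exact ⟨_, _, hb.1, fun j y => by linarith [(abs_lt.1 (hab j y).1).1],
      by linarith [(abs_lt.1 (hab k x).1).2], fun y => by linarith [(abs_lt.1 (hab k y).2).1]⟩
  · obtain ⟨b, hb, hab⟩ := happ ε hε
    have : b.2 k x ≤ 0 := hb.2.2 k x
    linarith [(abs_lt.1 (hab k x).2).2]

/-- Countably many reinforced subsolutions are combined into a single one. -/
theorem exists_reinforced_combination (hH : ∀ k, IsConvexHamiltonian (H k))
    (hB : ∀ i j, Continuous fun x => B x i j) (hBc : ∀ x, IsCoupling (B x))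
    (hBi : ∀ x, IsIrreducible (B x)) (hBd : ∀ x, IsDegenerate (B x)) (i : Fin m)
    {f v : ℕ → Fin m → Torus N → ℝ} (h : ∀ n, IsReinforcedSubsolution H B (f n) (v n)) :
    ∃ F V, IsReinforcedSubsolution H B F V ∧ ∀ n k x, f n k x < 0 → F k x < 0 := by
  obtain ⟨R, C, hR, hbd⟩ := subsolutions_exists_apriori_bound hH hB hBc hBi hBd 0
  have hv : ∀ n k, Continuous fun x => v n k x + -v n i 0 := fun n k =>
    ((h n).1.1 k).add continuous_const
  -- Truncating `f` at -1 and subtracting the constant `v n i 0` make the sequence bounded without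
  -- changing the sign of `f`.
  have hf : ∀ n k, Continuous fun x => max (f n k x) (-1) := fun n k =>
    ((h n).2.1 k).max continuous_const
  set a : ℕ → (Fin m → C(Torus N, ℝ)) × (Fin m → C(Torus N, ℝ)) := fun n =>
    (fun k => ⟨_, hv n k⟩, fun k => ⟨_, hf n k⟩) with ha
  have ha1 : ∀ n k x, (a n).1 k x = v n k x + -v n i 0 := fun n k x => rfl
  have ha2 : ∀ n k x, (a n).2 k x = max (f n k x) (-1) := fun n k x => rfl
  have hmem : ∀ n, a n ∈ reinforcedSet H B := fun n =>
    ⟨((h n).1.add_const hBd _).mono fun k x => le_max_left _ _, hf n,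
      fun k x => max_le ((h n).2.2 k x) (by norm_num)⟩
  have hK : ∀ n, ‖a n‖ ≤ max |C| 1 := fun n => by
    rw [Prod.norm_def]
    refine max_le_max ?_ ?_
    · refine (pi_norm_le_iff_of_nonneg (abs_nonneg C)).2 fun k =>
        (ContinuousMap.norm_le _ (abs_nonneg C)).2 fun x => ?_
      rw [ha1, Real.norm_eq_abs, abs_le]
      have h1 := (hbd _ (h n).mem).2 k i x 0
      have h2 := (hbd _ (h n).mem).2 i k 0 x
      have h3 := le_abs_self C
      constructor <;> linarith
    · refine (pi_norm_le_iff_of_nonneg zero_le_one).2 fun k =>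
        (ContinuousMap.norm_le _ zero_le_one).2 fun x => ?_
      rw [ha2, Real.norm_eq_abs, abs_le]
      exact ⟨le_max_right _ _, max_le (((h n).2.2 k x).trans zero_le_one) (by norm_num)⟩
  have : CompleteSpace (Fin m → C(Torus N, ℝ)) := inferInstance
  obtain ⟨s, hs, hsum⟩ := exists_hasSum_mem_of_isClosed_convex (isClosed_reinforcedSet hH hB hBc)
    (convex_reinforcedSet hH hB) hmem hK
  refine ⟨_, _, hs, fun n k x hlt => ?_⟩
  have hev : HasSum (fun n => (1 / 2 : ℝ) ^ (n + 1) * (a n).2 k x) (s.2 k x) := by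
    have h1 := hsum.mapL (ContinuousLinearMap.snd ℝ (Fin m → C(Torus N, ℝ)) (Fin m → C(Torus N, ℝ)))
    have h2 := h1.mapL (ContinuousLinearMap.proj (R := ℝ) (φ := fun _ : Fin m => C(Torus N, ℝ)) k)
    have h3 := h2.mapL (ContinuousMap.evalCLM ℝ x)
    simpa using h3
  refine hasSum_lt (f := fun n => (1 / 2 : ℝ) ^ (n + 1) * (a n).2 k x) (g := fun _ => (0 : ℝ))
    (i := n) (fun n' => ?_) ?_ hev hasSum_zero
  · exact mul_nonpos_of_nonneg_of_nonpos (by positivity) ((hmem n').2.2 k x)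
  · simp only [ha2]
    exact mul_neg_of_pos_of_neg (by positivity) (max_lt hlt (by norm_num))

theorem maneMatrix_eq_maneLevel (k i : Fin m) (y x : Torus N) :
    maneMatrix H B k i y x = maneLevel H B 0 i y k x := rfl

/-- Outside the Aubry set there are subsolutions all of whose components are strict. -/
theorem exists_strict_of_notMem_aubrySet (hH : ∀ k, IsConvexHamiltonian (H k))
    (hB : ∀ i j, Continuous fun x => B x i j) (hBc : ∀ x, IsCoupling (B x))
    (hBi : ∀ x, IsIrreducible (B x)) (hBd : ∀ x, IsDegenerate (B x))
    (hne : (subsolutions H B 0).Nonempty) {i : Fin m} {y : Torus N} (hy : y ∉ aubrySet H B i) :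
    ∃ f v, IsReinforcedSubsolution H B f v ∧ ∀ k, f k y < 0 := by
  obtain ⟨R, C, hR, hbd⟩ := subsolutions_exists_apriori_bound hH hB hBc hBi hBd 0
  have hw := isSubsolutionWith_maneLevel hbd hne hH hB hBc hBd hR i y
  have hnot : ∃ k x, ∃ p ∈ subdifferential (maneLevel H B 0 i y k) x,
      H k x p + couplingTerm B (maneLevel H B 0 i y) k x < 0 := by
    by_contra! hall
    exact hy ⟨isSubsolution_iff.2 hw, hw.1, hall⟩
  obtain ⟨k, x, p, hp, hlt⟩ := hnot
  -- A competitor that keeps the value 0 of component `i` at `y` stays below the Mañé function, so a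
  -- raise must touch component `i` at `y`.
  have hmax : ∀ w' f, IsReinforcedSubsolution H B f w' →
      w' i y = maneLevel H B 0 i y i y → w' k x ≤ maneLevel H B 0 i y k x := fun w' f hw' h0 => by
    rw [maneLevel_self hne] at h0
    have := le_maneLevel hbd hw'.mem i y k x
    rwa [h0, sub_zero] at this
  have hki : k = i := by
    by_contra hki
    obtain ⟨w', f, hw', -, hj, hgt, -⟩ := exists_strict_component hH hB hBc hw hp hlt univ_mem
    exact absurd (hmax w' f hw' (by rw [hj i (Ne.symm hki)])) (not_le.2 hgt)
  subst hki
  have hxy : x = y := by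
    by_contra hxy
    obtain ⟨w', f, hw', -, -, hgt, hO⟩ := exists_strict_component hH hB hBc hw hp hlt
      (isOpen_compl_singleton.mem_nhds (show x ∈ ({y} : Set (Torus N))ᶜ from hxy))
    exact absurd (hmax w' f hw' (hO y (by simp))) (not_le.2 hgt)
  subst hxy
  obtain ⟨w', f, hw', hf, -⟩ := exists_strict_component hH hB hBc hw hp hlt univ_mem
  exact IsReinforcedSubsolution.exists_strict hH hB hBc (hBi x) _ f w' hw' hf le_rfl

/-- A single subsolution which is strict outside of the Aubry set. -/
theorem exists_strict_outside_aubrySet (hH : ∀ k, IsConvexHamiltonian (H k))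
    (hB : ∀ i j, Continuous fun x => B x i j) (hBc : ∀ x, IsCoupling (B x))
    (hBi : ∀ x, IsIrreducible (B x)) (hBd : ∀ x, IsDegenerate (B x))
    (hne : (subsolutions H B 0).Nonempty) (i : Fin m) :
    ∃ f v, IsReinforcedSubsolution H B f v ∧ ∀ y ∉ aubrySet H B i, ∀ k, f k y < 0 := by
  choose f v hfv hneg using fun y : {y // y ∉ aubrySet H B i} =>
    exists_strict_of_notMem_aubrySet hH hB hBc hBi hBd hne y.2
  -- Lindelöf property: countably many of the open sets of strictness cover the complement of the
  -- Aubry set.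
  obtain ⟨T, hT, hTU⟩ := TopologicalSpace.isOpen_iUnion_countable
    (fun y : {y // y ∉ aubrySet H B i} => {x | ∀ k, f y k x < 0}) fun y => by
      simp only [ofPred_forall]
      exact isOpen_iInter_of_finite fun k => isOpen_lt ((hfv y).2.1 k) continuous_const
  rcases T.eq_empty_or_nonempty with rfl | hTne
  · obtain ⟨u, hu⟩ := hne
    refine ⟨fun _ _ => 0, u, ⟨isSubsolution_iff.1 hu, fun _ => continuous_const, fun _ _ => le_rfl⟩,
      fun y hy => ?_⟩
    have : y ∈ ⋃ y : {y // y ∉ aubrySet H B i}, {x | ∀ k, f y k x < 0} :=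
      mem_iUnion.2 ⟨⟨y, hy⟩, hneg ⟨y, hy⟩⟩
    rw [← hTU] at this
    simp at this
  · obtain ⟨e, rfl⟩ := hT.exists_eq_range hTne
    obtain ⟨F, V, hFV, hF⟩ := exists_reinforced_combination hH hB hBc hBi hBd i
      fun n => hfv (e n)
    refine ⟨F, V, hFV, fun y hy k => ?_⟩
    have : y ∈ ⋃ y : {y // y ∉ aubrySet H B i}, {x | ∀ k, f y k x < 0} :=
      mem_iUnion.2 ⟨⟨y, hy⟩, hneg ⟨y, hy⟩⟩
    rw [← hTU] at this
    simp only [mem_iUnion, mem_range] at this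
    obtain ⟨_, ⟨n, rfl⟩, hn⟩ := this
    exact hF n k y (hn k)

/-- Subsolutions are Lipschitz, hence differentiable almost everywhere by Rademacher's theorem.
There the gradient is a limit of superjets at nearby points, and the inequality with right-hand side
`f` passes to the limit. -/
theorem IsReinforcedSubsolution.isStrictAt (hH : ∀ k, IsConvexHamiltonian (H k))
    (hB : ∀ i j, Continuous fun x => B x i j) {f v : Fin m → Torus N → ℝ}
    (h : IsReinforcedSubsolution H B f v) {y : Torus N} (hy : ∀ k, f k y < 0) :
    IsStrictAt H B v y := by
  intro k
  obtain ⟨δ, hδ, hlt⟩ : ∃ δ > 0, f k y < -δ :=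
    ⟨-f k y / 2, by linarith [hy k], by linarith [hy k]⟩
  refine ⟨{x | f k x < -δ}, isOpen_lt (h.2.1 k) continuous_const, hlt, δ, hδ, ?_⟩
  obtain ⟨R, hR0, hR⟩ := h.1.exists_superjet_bound hH hB h.2.1
  have hlip : LipschitzWith ⟨R, hR0⟩ fun z => v k (proj z) :=
    LipschitzWith.of_dist_le_mul fun z w => by
      rw [Real.dist_eq, dist_eq_norm, abs_sub_le_iff]
      exact ⟨h.1.lipschitz hR0 hR k w z, by
        rw [norm_sub_rev]; exact h.1.lipschitz hR0 hR k z w⟩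
  filter_upwards [hlip.ae_differentiableAt] with z hz hzV
  refine ⟨hz, lt_of_le_of_lt ?_ (show f k (proj z) < -δ from hzV)⟩
  by_contra! hgt
  have hcont : Continuous fun a : Euc N × Euc N =>
      H k (proj a.1) a.2 + couplingTerm B v k (proj a.1) - f k (proj a.1) :=
    (((hH k).continuous.comp ((continuous_proj.comp continuous_fst).prodMk continuous_snd)).add
      ((continuous_couplingTerm hB h.1.1 k).comp (continuous_proj.comp continuous_fst))).sub
      ((h.2.1 k).comp (continuous_proj.comp continuous_fst))
  obtain ⟨ε, hε, hball⟩ := Metric.mem_nhds_iff.1 ((hcont.continuousAt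
    (x := (z, gradient (fun w => v k (proj w)) z))).eventually (lt_mem_nhds (sub_pos.2 hgt)))
  obtain ⟨w, hw, q, hq, hqd⟩ := superjet_near_of_hasGradientAt
    ((h.1.1 k).comp continuous_proj) hz.hasGradientAt hε
  have h1 := hball (show (w, q) ∈ Metric.ball _ ε by
    rw [Metric.mem_ball, Prod.dist_eq]; exact max_lt hw hqd)
  have h2 := h.1.2 k w q hq
  simp only [mem_ofPred_eq] at h1
  linarith

/-- The Mañé function is Lipschitz in its base point, uniformly in the other variable, so stability
transfers the supersolution property to limits of base points. The subsolution property holds for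
every base point. -/
theorem isClosed_aubrySet (hH : ∀ k, IsConvexHamiltonian (H k))
    (hB : ∀ i j, Continuous fun x => B x i j) (hBc : ∀ x, IsCoupling (B x))
    (hBi : ∀ x, IsIrreducible (B x)) (hBd : ∀ x, IsDegenerate (B x))
    (hne : (subsolutions H B 0).Nonempty) (i : Fin m) : IsClosed (aubrySet H B i) := by
  obtain ⟨R, C, hR, hbd⟩ := subsolutions_exists_apriori_bound hH hB hBc hBi hBd 0
  refine isClosed_of_closure_subset fun y hy => ?_
  have hw := isSubsolutionWith_maneLevel hbd hne hH hB hBc hBd hR i y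
  refine ⟨isSubsolution_iff.2 hw, isSupersolution_iff.2 (isSubsolutionWith_of_approx (fun k => ?_) hB
    hBc (fun k => (hw.1 k).neg) (fun _ => continuous_const) fun k x ε hε => ?_)⟩
  · exact ((hH k).continuous.comp (continuous_fst.prodMk continuous_snd.neg)).neg
  obtain ⟨z, rfl⟩ := proj_surjective y
  have hr : 0 < ε / (R + 1) := by positivity
  obtain ⟨_, ⟨z', hz', rfl⟩, hA⟩ := mem_closure_iff_nhds.1 hy _
    (isOpenQuotientMap_proj.isOpenMap.image_mem_nhds (Metric.ball_mem_nhds z hr))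
  have hle : R * ‖z' - z‖ ≤ ε := by
    rw [mem_ball_iff_norm, lt_div_iff₀ (by positivity)] at hz'
    nlinarith [norm_nonneg (z' - z)]
  refine ⟨_, _, isSupersolution_iff.1 hA.2, fun j x' => ?_, ?_, fun _ => by linarith⟩
  · have := maneLevel_lipschitz_base hbd hne i j x' z' z
    rw [norm_sub_rev] at this
    simp only [maneMatrix_eq_maneLevel]
    linarith
  · have := maneLevel_lipschitz_base hbd hne i k x z z'
    simp only [maneMatrix_eq_maneLevel]
    linarith

/-- Otherwise `f` is negative on the whole compact torus, hence at most some `-δ < 0`, and `v` is a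
subsolution at a level below the critical one. The lower bound on levels makes the critical value a
genuine infimum here. -/
theorem nonempty_aubrySet (hH : ∀ k, IsConvexHamiltonian (H k)) (hBc : ∀ x, IsCoupling (B x))
    (hBd : ∀ x, IsDegenerate (B x)) (hc : criticalValue H B = 0) (i : Fin m)
    {f v : Fin m → Torus N → ℝ} (h : IsReinforcedSubsolution H B f v)
    (hf : ∀ y ∉ aubrySet H B i, ∀ k, f k y < 0) : (aubrySet H B i).Nonempty := by
  by_contra hempty
  rw [not_nonempty_iff_eq_empty] at hempty
  have hneg : ∀ k y, f k y < 0 := fun k y => hf y (by simp [hempty]) k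
  have key : ∀ k, ∃ δ > 0, ∀ x, f k x ≤ -δ := fun k => by
    obtain ⟨x, -, hx⟩ := isCompact_univ.exists_isMaxOn univ_nonempty (h.2.1 k).continuousOn
    exact ⟨-f k x, by linarith [hneg k x], fun y => by simpa using hx (mem_univ y)⟩
  choose δ hδ hfδ using key
  have : Nonempty (Fin m) := ⟨i⟩
  obtain ⟨k, hk⟩ := Finite.exists_min δ
  have hmem : (subsolutions H B (-δ k)).Nonempty :=
    ⟨v, isSubsolution_iff.2 (h.1.mono fun j x => (hfδ j x).trans (neg_le_neg (hk j)))⟩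
  have := csInf_le (bddBelow_levels hH hBc hBd i) hmem
  rw [← criticalValue, hc] at this
  linarith [hδ k]

end Main

end WeaklyCoupled

theorem mainTheorem2 {N m : ℕ}
    (H : Fin m → WeaklyCoupled.Torus N → WeaklyCoupled.Euc N → ℝ)
    (hH : ∀ i, WeaklyCoupled.IsConvexHamiltonian (H i))
    (B : WeaklyCoupled.Torus N → Matrix (Fin m) (Fin m) ℝ)
    (hBcont : ∀ i j, Continuous (fun x => B x i j))
    (hBcoupling : ∀ x, WeaklyCoupled.IsCoupling (B x))
    (hBirreducible : ∀ x, WeaklyCoupled.IsIrreducible (B x))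
    (hBdegenerate : ∀ x, WeaklyCoupled.IsDegenerate (B x))
    (hc : WeaklyCoupled.criticalValue H B = 0)
    (i : Fin m) :
    (∃ v ∈ WeaklyCoupled.subsolutions H B 0,
      ∀ y ∉ WeaklyCoupled.aubrySet H B i, WeaklyCoupled.IsStrictAt H B v y) ∧
    IsClosed (WeaklyCoupled.aubrySet H B i) ∧
    (WeaklyCoupled.aubrySet H B i).Nonempty := by
  have hne := WeaklyCoupled.exists_critical_subsolution hH hBcont hBcoupling hBirreducible
    hBdegenerate hc i
  obtain ⟨f, v, h, hf⟩ := WeaklyCoupled.exists_strict_outside_aubrySet hH hBcont hBcoupling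
    hBirreducible hBdegenerate hne i
  exact ⟨⟨v, h.mem, fun y hy => h.isStrictAt hH hBcont (hf y hy)⟩,
    WeaklyCoupled.isClosed_aubrySet hH hBcont hBcoupling hBirreducible hBdegenerate hne i,
    WeaklyCoupled.nonempty_aubrySet hH hBcoupling hBdegenerate hc i h hf⟩
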